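/- For a real number $\alpha\notin\mathbb{Z}$ set $$K(\alpha)=\begin{cases}|\sin(2\pi\alpha)|^{-1}, & \alpha \bmod 1\in(0,1/4)\cup(3/4,1),\\ 1, & \alpha\bmod 1\in[1/4,3/4],\end{cases}$$ and for $\gamma\ge 1$ let $$L^{\mathrm{cl}}_{\gamma,1}=\frac1{2\pi}\int_{\mathbb{R}}(1-\xi^2)_+^{\gamma}\,d\xi .$$ For every $\gamma\ge1$ and every $\alpha\in\mathbb{R}\setminus\mathbb{Z}$ there is a constant $L_{\gamma,1}\ge 0$, depending only on $\gamma$ and $\alpha$, with $$L_{\gamma,1}\le\frac{2}{3\sqrt3}\,K(\alpha)\,\frac{L^{\mathrm{cl}}_{\gamma,1}}{L^{\mathrm{cl}}_{1,1}}=\frac{\pi}{\sqrt3}\,K(\alpha)\,L^{\mathrm{cl}}_{\gamma,1},$$ such that the following holds. Let $M$ be a natural number, let $a\in L^1(0,2\pi)$ be a real magnetic potential with flux $\frac1{2\pi}\int_0^{2\pi}a(x)\,dx=\alpha$, and let $V$ be a measurable function on $(0,2\pi)$ with values in the positive semidefinite Hermitian $M\times M$ matrices such that $\mathrm{Tr}\,[V^{\gamma+1/2}]\in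 L^1(0,2\pi)$. Let $H=\left(i\frac{d}{dx}-a(x)\right)^2-V(x)$ be the operator in $L^2(\mathbb{S}^1;\mathbb{C}^M)$, $\mathbb{S}^1=\mathbb{R}/2\pi\mathbb{Z}$, associated with the quadratic form $\int_0^{2\pi}\left|i u'-a u\right|^2dx-\int_0^{2\pi}\langle u,Vu\rangle\,dx$ on the $2\pi$-periodic absolutely continuous functions $u$ with $iu'-au\in L^2$. Then the negative eigenvalues $-\lambda_n<0$ of $H$, counted with multiplicity, satisfy $$\sum_n\lambda_n^{\gamma}\le L_{\gamma,1}\int_0^{2\pi}\mathrm{Tr}\,[V(x)^{\gamma+1/2}]\,dx .$$ -/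

import Mathlib

open Real MeasureTheory Set
open scoped ENNReal ComplexOrder

namespace MagneticLT

noncomputable section

/-- The fibre `ℂ^M` with its Hermitian inner product. -/
abbrev Fibre (M : ℕ) : Type := EuclideanSpace ℂ (Fin M)

/-- Lebesgue measure on the circle, realised as the period interval `(0, 2π]`. -/
abbrev circleMeasure : Measure ℝ := volume.restrict (Ioc 0 (2 * π))

/-- The Hilbert space `L²(𝕊¹; ℂ^M)`. -/
abbrev L2 (M : ℕ) : Type := Lp (Fibre M) 2 circleMeasure

/-- The flux `α = (1/2π) ∫₀^{2π} a(x) dx` of a magnetic potential. -/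
def flux (a : ℝ → ℝ) : ℝ := 1 / (2 * π) * ∫ x in (0 : ℝ)..(2 * π), a x

/-- The constant `K(α)`, for `α ∉ ℤ`. -/
def K (α : ℝ) : ℝ :=
  if Int.fract α ∈ Icc (1 / 4 : ℝ) (3 / 4) then 1 else |sin (2 * π * α)|⁻¹

/-- The one-dimensional semiclassical constant
`L^cl_{γ,1} = (1/2π) ∫_ℝ (1 - ξ²)₊^γ dξ`. -/
def Lcl (γ : ℝ) : ℝ := 1 / (2 * π) * ∫ ξ : ℝ, (max (1 - ξ ^ 2) 0) ^ γ

/-- The trace `Tr[W^s]`, with `W^s` defined by the functional calculus of the Hermitian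
matrix `W`. -/
def tracePow {M : ℕ} (W : Matrix (Fin M) (Fin M) ℂ) (s : ℝ) : ℝ :=
  (Matrix.trace (cfc (fun t : ℝ => t ^ s) W)).re

/-- The magnetic derivative `i d/dx - a` with periodic boundary conditions in `L²(𝕊¹; ℂ^M)`,
given by its graph: `(u, g)` belongs to it when `u` has an absolutely continuous
representative `f` on `[0, 2π]`, with derivative `f'` and `f(0) = f(2π)`, such that
`g = i f' - a f`. The form domain of `(i d/dx - a)²` consists of the `u` occurring here. -/
def magneticDeriv {M : ℕ} (a : ℝ → ℝ) : Submodule ℂ (L2 M × L2 M) where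
  carrier := {p | ∃ f f' : ℝ → Fibre M,
    IntervalIntegrable f' volume 0 (2 * π) ∧
    (∀ x ∈ Icc (0 : ℝ) (2 * π), f x = f 0 + ∫ t in (0 : ℝ)..x, f' t) ∧
    f 0 = f (2 * π) ∧
    p.1 =ᵐ[circleMeasure] f ∧
    p.2 =ᵐ[circleMeasure] fun x => Complex.I • f' x - (a x : ℂ) • f x}
  add_mem' := by
    rintro ⟨u, g⟩ ⟨v, k⟩ ⟨f, f', hi, hf, hp, hu, hg⟩ ⟨e, e', hi', he, hp', hv, hk⟩
    refine ⟨f + e, f' + e', hi.add hi', ?_, ?_, ?_, ?_⟩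
    · intro x hx
      have hsub : uIcc (0 : ℝ) x ⊆ uIcc 0 (2 * π) := by
        rw [uIcc_of_le hx.1, uIcc_of_le (hx.1.trans hx.2)]
        exact Icc_subset_Icc_right hx.2
      have h := intervalIntegral.integral_add (hi.mono_set hsub) (hi'.mono_set hsub)
      simp only [Pi.add_apply]
      rw [h, hf x hx, he x hx]
      abel
    · simp only [Pi.add_apply, hp, hp']
    · filter_upwards [hu, hv, Lp.coeFn_add u v] with x h1 h2 h3
      simp only [Prod.fst_add, Pi.add_apply] at *
      rw [h3, h1, h2]
    · filter_upwards [hg, hk, Lp.coeFn_add g k] with x h1 h2 h3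
      simp only [Prod.snd_add, Pi.add_apply] at *
      rw [h3, h1, h2, smul_add, smul_add]
      abel
  zero_mem' := by
    refine ⟨0, 0, ?_, ?_, rfl, ?_, ?_⟩
    · exact intervalIntegrable_const
    · intro x _
      simp
    · exact Lp.coeFn_zero _ _ _
    · filter_upwards [Lp.coeFn_zero (Fibre M) 2 circleMeasure] with x hx
      simpa using hx
  smul_mem' := by
    rintro c ⟨u, g⟩ ⟨f, f', hi, hf, hp, hu, hg⟩
    refine ⟨c • f, c • f', hi.smul c, ?_, ?_, ?_, ?_⟩
    · intro x hx
      simp only [Pi.smul_apply, intervalIntegral.integral_smul]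
      rw [hf x hx, smul_add]
    · simp only [Pi.smul_apply, hp]
    · filter_upwards [hu, Lp.coeFn_smul c u] with x h1 h2
      simp only [Prod.smul_fst, Pi.smul_apply] at *
      rw [h2, h1]
    · filter_upwards [hg, Lp.coeFn_smul c g] with x h1 h2
      simp only [Prod.smul_snd, Pi.smul_apply] at *
      rw [h2, h1, smul_sub, smul_comm c, smul_comm c]

/-- The density `⟨v(x), V(x) u(x)⟩` of the sesquilinear form of the potential
(conjugate-linear in `v`). -/
def potentialDensity {M : ℕ} (V : ℝ → Matrix (Fin M) (Fin M) ℂ) (v u : L2 M) (x : ℝ) : ℂ :=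
  inner ℂ (v x) (Matrix.toEuclideanLin (V x) (u x))

/-- The graph of the self-adjoint operator `H = (i d/dx - a)² - V` in `L²(𝕊¹; ℂ^M)` that is
associated with the quadratic form `∫ |(i d/dx - a) u|² - ∫ ⟨u, V u⟩`: the pair `(u, h)`
belongs to it when `u` lies in the form domain and, for all `v` in the form domain,
`⟨(i d/dx - a) v, (i d/dx - a) u⟩ - ∫ ⟨v, V u⟩ = ⟨v, h⟩`. -/
def schrodingerGraph {M : ℕ} (a : ℝ → ℝ) (V : ℝ → Matrix (Fin M) (Fin M) ℂ) :
    Submodule ℂ (L2 M × L2 M) where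
  carrier := {p | ∃ g : L2 M, (p.1, g) ∈ magneticDeriv a ∧
    ∀ v k : L2 M, (v, k) ∈ magneticDeriv a →
      Integrable (potentialDensity V v p.1) circleMeasure ∧
      inner ℂ k g - ∫ x, potentialDensity V v p.1 x ∂circleMeasure = inner ℂ v p.2}
  add_mem' := by
    rintro ⟨u, h⟩ ⟨u', h'⟩ ⟨g, hg, H⟩ ⟨g', hg', H'⟩
    refine ⟨g + g', (magneticDeriv a).add_mem hg hg', fun v k hv => ?_⟩
    obtain ⟨i1, e1⟩ := H v k hv
    obtain ⟨i2, e2⟩ := H' v k hv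
    have hae : potentialDensity V v (u + u') =ᵐ[circleMeasure]
        potentialDensity V v u + potentialDensity V v u' := by
      filter_upwards [Lp.coeFn_add u u'] with x hx
      simp only [potentialDensity, Pi.add_apply, hx, map_add, inner_add_right]
    refine ⟨(i1.add i2).congr hae.symm, ?_⟩
    simp only [Prod.mk_add_mk]
    rw [integral_congr_ae hae, integral_add' i1 i2, inner_add_right, inner_add_right,
      ← e1, ← e2]
    ring
  zero_mem' := by
    refine ⟨0, (magneticDeriv a).zero_mem, fun v k _ => ?_⟩
    have hae : potentialDensity V v 0 =ᵐ[circleMeasure] 0 := by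
      filter_upwards [Lp.coeFn_zero (Fibre M) 2 circleMeasure] with x hx
      simp only [potentialDensity, hx, Pi.zero_apply, map_zero, inner_zero_right]
    refine ⟨(integrable_zero ℝ ℂ circleMeasure).congr hae.symm, ?_⟩
    simp only [Prod.fst_zero, Prod.snd_zero]
    rw [integral_congr_ae hae]
    simp
  smul_mem' := by
    rintro c ⟨u, h⟩ ⟨g, hg, H⟩
    refine ⟨c • g, (magneticDeriv a).smul_mem c hg, fun v k hv => ?_⟩
    obtain ⟨i1, e1⟩ := H v k hv
    have hae : potentialDensity V v (c • u) =ᵐ[circleMeasure]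
        c • potentialDensity V v u := by
      filter_upwards [Lp.coeFn_smul c u] with x hx
      simp only [potentialDensity, Pi.smul_apply, hx, map_smul, inner_smul_right, smul_eq_mul]
    refine ⟨(i1.smul c).congr hae.symm, ?_⟩
    simp only [Prod.smul_mk]
    rw [integral_congr_ae hae]
    simp only [Pi.smul_apply]
    rw [integral_smul, inner_smul_right, inner_smul_right, ← e1, smul_eq_mul]
    ring

/-- The eigenspace `{u : H u = E u}` of `H = (i d/dx - a)² - V`. -/
def eigenspace {M : ℕ} (a : ℝ → ℝ) (V : ℝ → Matrix (Fin M) (Fin M) ℂ) (E : ℝ) :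
    Submodule ℂ (L2 M) :=
  (schrodingerGraph a V).comap
    (LinearMap.prod LinearMap.id ((E : ℂ) • (LinearMap.id : L2 M →ₗ[ℂ] L2 M)))

/-- The multiplicity of `E` as an eigenvalue of `H` (`0` if `E` is not an eigenvalue). -/
def multiplicity {M : ℕ} (a : ℝ → ℝ) (V : ℝ → Matrix (Fin M) (Fin M) ℂ) (E : ℝ) : ℕ∞ :=
  (Module.rank ℂ (eigenspace a V E)).toENat

/-- The Riesz mean `∑ λ_n^γ` over the negative eigenvalues `-λ_n` of
`H = (i d/dx - a)² - V`, each counted with its multiplicity. -/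
def rieszMean {M : ℕ} (a : ℝ → ℝ) (V : ℝ → Matrix (Fin M) (Fin M) ℂ) (γ : ℝ) : ℝ≥0∞ :=
  ∑' E : Iio (0 : ℝ), ENNReal.ofReal ((-(E : ℝ)) ^ γ) * (multiplicity a V E : ℝ≥0∞)

end

end MagneticLT

/-! The heart is the interpolation inequality |f(x)|² ≤ K(α) ‖f‖ ‖(i d/dx − a)f‖
(`norm_sq_le_of_flux`). The gauge factor exp(i∫a) removes a and turns periodicity into the twist
w(2π) = θ w(0), θ = exp(2πiα). Integrating the derivative of ⟨w(x), w(2π − x)⟩ up to the midpoint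
gives |θ|w(0)|² − |w(π)|²| ≤ ‖w‖ ‖w'‖, and 1/K(α) is the distance from θ to the ray [0, ∞).
Translating the window moves 0 to any x.

Applied to linear combinations of an orthonormal family u_i with magnetic derivatives g_i, this
controls the matrix U(x) = ∑ |u_i(x)⟩⟨u_i(x)|: its diagonal entries in any orthonormal basis, cubed
and summed, are at most K² times a Gram expression that integrates to ∑ ‖g_i‖² (`sum_cube_le`). In
an eigenbasis of V(x), Young's inequality absorbs these cubes, so the constant does not depend on M.
For eigenfunctions this yields ∑ (λ_i − t) ≤ 2/(3√3) K ∫ Tr (V − t)₊^{3/2} for every t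
(`ofReal_sum_sub_le`).

The case γ = 1 is t = 0. For γ > 1 the shifted bounds are integrated against γ(γ−1)t^(γ−2)
(Aizenman–Lieb), at the price of the factor L^cl_γ / L^cl_1. Finite families suffice, since the
Riesz mean is a supremum over them. -/

namespace MagneticLT

/-! ### Calculus of absolutely continuous functions -/

section AbsolutelyContinuous

variable {E X Y Z : Type*} [NormedAddCommGroup E] [NormedSpace ℝ E]
  [PseudoMetricSpace X] [PseudoMetricSpace Y] [PseudoMetricSpace Z]

/-- `F` is a primitive of the integrable function `F'` on `[p, q]`. -/
def IsPrimitive (F F' : ℝ → E) (p q : ℝ) : Prop :=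
  IntervalIntegrable F' volume p q ∧ ∀ x ∈ Icc p q, F x = F p + ∫ t in p..x, F' t

/-- Absolute continuity says that sums of increments vanish along short disjoint families, so it
passes to anything whose increments are dominated. Two majorants allow for products. -/
theorem absolutelyContinuousOnInterval_of_dist_le {h : ℝ → X} {f : ℝ → Y} {g : ℝ → Z} {p q C : ℝ}
    (hF : AbsolutelyContinuousOnInterval f p q) (hG : AbsolutelyContinuousOnInterval g p q)
    (hle : ∀ x ∈ uIcc p q, ∀ y ∈ uIcc p q,
      dist (h x) (h y) ≤ C * (dist (f x) (f y) + dist (g x) (g y))) :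
    AbsolutelyContinuousOnInterval h p q := by
  have hlim := (Filter.Tendsto.add hF hG).const_mul C
  simp only [add_zero, mul_zero] at hlim
  refine squeeze_zero' ?_ ?_ hlim
  · filter_upwards with E
    exact Finset.sum_nonneg fun _ _ => dist_nonneg
  · have : ∀ᶠ (E : ℕ × (ℕ → ℝ × ℝ)) in AbsolutelyContinuousOnInterval.totalLengthFilter ⊓
        Filter.principal (AbsolutelyContinuousOnInterval.disjWithin p q),
        E ∈ AbsolutelyContinuousOnInterval.disjWithin p q :=
      Filter.eventually_inf_principal.mpr (by simp)
    filter_upwards [this] with E hE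
    rw [← Finset.sum_add_distrib, Finset.mul_sum]
    exact Finset.sum_le_sum fun i hi => hle _ (hE.1 i hi).1 _ (hE.1 i hi).2

theorem IsPrimitive.sub_eq {F F' : ℝ → E} {p q x y : ℝ} (h : IsPrimitive F F' p q)
    (hx : x ∈ Icc p q) (hy : y ∈ Icc p q) : F y - F x = ∫ t in x..y, F' t := by
  rw [h.2 x hx, h.2 y hy, add_sub_add_left_eq_sub]
  refine intervalIntegral.integral_interval_sub_left (h.1.mono_set ?_) (h.1.mono_set ?_)
  · rw [uIcc_of_le hy.1, uIcc_of_le (hy.1.trans hy.2)]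
    exact Icc_subset_Icc_right hy.2
  · rw [uIcc_of_le hx.1, uIcc_of_le (hx.1.trans hx.2)]
    exact Icc_subset_Icc_right hx.2

theorem IsPrimitive.absolutelyContinuous {F F' : ℝ → E} {p q : ℝ} (hpq : p ≤ q)
    (h : IsPrimitive F F' p q) : AbsolutelyContinuousOnInterval F p q := by
  have hN := h.1.norm.absolutelyContinuousOnInterval_intervalIntegral (c := p) (by simp)
  -- One majorant suffices here; the second is the zero function.
  refine absolutelyContinuousOnInterval_of_dist_le (C := 1) hN
    (hN.const_smul (0 : ℝ)) fun x hx y hy => ?_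
  rw [uIcc_of_le hpq] at hx hy
  have hN' : IsPrimitive (fun x => ∫ v in p..x, ‖F' v‖) (fun v => ‖F' v‖) p q :=
    ⟨h.1.norm, fun x _ => by simp⟩
  rw [dist_comm, dist_eq_norm, h.sub_eq hx hy, dist_comm, dist_eq_norm, hN'.sub_eq hx hy]
  simp only [zero_smul, dist_self, add_zero, one_mul]
  exact intervalIntegral.norm_integral_le_abs_integral_norm

theorem IsPrimitive.continuousOn {F F' : ℝ → E} {p q : ℝ} (hpq : p ≤ q)
    (h : IsPrimitive F F' p q) : ContinuousOn F (Icc p q) := by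
  simpa [uIcc_of_le hpq] using (h.absolutelyContinuous hpq).continuousOn

theorem IsPrimitive.ae_hasDerivAt [CompleteSpace E] {F F' : ℝ → E} {p q : ℝ} (h : IsPrimitive F F' p q) :
    ∀ᵐ x, x ∈ Ioo p q → HasDerivAt F (F' x) x := by
  filter_upwards [h.1.ae_hasDerivAt_integral] with x hx hxI
  have hpq : p ≤ q := (hxI.1.trans hxI.2).le
  have hd := (hx (by rw [uIcc_of_le hpq]; exact Ioo_subset_Icc_self hxI) p (by simp)).const_add (F p)
  refine hd.congr_of_eventuallyEq ?_
  filter_upwards [Ioo_mem_nhds hxI.1 hxI.2] with y hy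
  exact h.2 y (Ioo_subset_Icc_self hy)

/-- The difference between `F` and the integral of `F'` is absolutely continuous with derivative
zero almost everywhere, hence constant. The product rules below follow by differentiating almost
everywhere. -/
theorem isPrimitive_of_ae_hasDerivAt [CompleteSpace E] {F F' : ℝ → E} {p q : ℝ} (hpq : p ≤ q)
    (hF : AbsolutelyContinuousOnInterval F p q)
    (hd : ∀ᵐ x, x ∈ Ioo p q → HasDerivAt F (F' x) x)
    (hi : IntervalIntegrable F' volume p q) : IsPrimitive F F' p q := by
  have hG : IsPrimitive (fun x => ∫ v in p..x, F' v) F' p q := ⟨hi, fun x _ => by simp⟩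
  have hac := hF.sub (hG.absolutelyContinuous hpq)
  obtain ⟨C, hC⟩ := hac.const_of_ae_hasDerivAt_zero (by
    have h1 : ∀ᵐ x : ℝ, x ≠ p := by simp [ae_iff, measure_singleton]
    have h2 : ∀ᵐ x : ℝ, x ≠ q := by simp [ae_iff, measure_singleton]
    filter_upwards [hd, hG.ae_hasDerivAt, h1, h2] with x hx1 hx2 hxp hxq hx
    rw [uIcc_of_le hpq] at hx
    have hx' : x ∈ Ioo p q := ⟨lt_of_le_of_ne hx.1 hxp.symm, lt_of_le_of_ne hx.2 hxq⟩
    simpa using (hx1 hx').sub (hx2 hx'))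
  refine ⟨hi, fun x hx => ?_⟩
  rw [uIcc_of_le hpq] at hC
  have e1 := hC x hx
  have e2 := hC p (left_mem_Icc.2 hpq)
  simp only [Pi.sub_apply, intervalIntegral.integral_same, sub_zero] at e1 e2
  rw [e2, ← e1]
  abel

theorem IsPrimitive.reflect {F F' : ℝ → E} {q : ℝ} (h : IsPrimitive F F' 0 q) :
    IsPrimitive (fun s => F (q - s)) (fun s => -F' (q - s)) 0 q := by
  refine ⟨?_, fun x hx => ?_⟩
  · have := (h.1.comp_sub_left q).symm.neg
    simp only [sub_self, sub_zero] at this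
    exact this
  · have := h.sub_eq (x := q - x) (y := q) ⟨by linarith [hx.2], by linarith [hx.1]⟩
      ⟨hx.1.trans hx.2, le_rfl⟩
    simp only [sub_zero, intervalIntegral.integral_neg,
      intervalIntegral.integral_comp_sub_left F' q]
    rw [← this]
    abel

theorem IsPrimitive.smul {c c' : ℝ → ℂ} {H : Type*} [NormedAddCommGroup H] [NormedSpace ℂ H]
    [CompleteSpace H] {F F' : ℝ → H} {p q : ℝ} (hpq : p ≤ q)
    (hc : IsPrimitive c c' p q) (hF : IsPrimitive F F' p q) :
    IsPrimitive (fun x => c x • F x) (fun x => c x • F' x + c' x • F x) p q := by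
  refine isPrimitive_of_ae_hasDerivAt hpq
    ((hc.absolutelyContinuous hpq).smul (hF.absolutelyContinuous hpq)) ?_ ?_
  · filter_upwards [hc.ae_hasDerivAt, hF.ae_hasDerivAt] with x h1 h2 hx
    exact (h1 hx).smul (h2 hx)
  · refine (hF.1.continuousOn_smul ?_).add (hc.1.smul_continuousOn ?_)
    · rw [uIcc_of_le hpq]; exact hc.continuousOn hpq
    · rw [uIcc_of_le hpq]; exact hF.continuousOn hpq

theorem IsPrimitive.inner_apply {H : Type*} [NormedAddCommGroup H] [InnerProductSpace ℂ H]
    [CompleteSpace H] {F F' G G' : ℝ → H} {p q : ℝ} (hpq : p ≤ q)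
    (hF : IsPrimitive F F' p q) (hG : IsPrimitive G G' p q) :
    IsPrimitive (fun x => inner ℂ (F x) (G x))
      (fun x => inner ℂ (F x) (G' x) + inner ℂ (F' x) (G x)) p q := by
  have hFa := hF.absolutelyContinuous hpq
  have hGa := hG.absolutelyContinuous hpq
  obtain ⟨C, hC⟩ := hFa.exists_bound
  obtain ⟨D, hD⟩ := hGa.exists_bound
  refine isPrimitive_of_ae_hasDerivAt hpq ?_ ?_ ?_
  · refine absolutelyContinuousOnInterval_of_dist_le (C := max C D) hFa hGa fun x hx y hy => ?_
    have : inner ℂ (F x) (G x) - inner ℂ (F y) (G y) =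
        inner ℂ (F x - F y) (G x) + inner ℂ (F y) (G x - G y) := by
      rw [inner_sub_left, inner_sub_right]; ring
    rw [dist_eq_norm, dist_eq_norm, dist_eq_norm, this]
    calc _ ≤ ‖F x - F y‖ * ‖G x‖ + ‖F y‖ * ‖G x - G y‖ :=
          (norm_add_le _ _).trans (add_le_add (norm_inner_le_norm _ _) (norm_inner_le_norm _ _))
      _ ≤ ‖F x - F y‖ * max C D + max C D * ‖G x - G y‖ := by
          gcongr
          · exact (hD x hx).trans (le_max_right _ _)
          · exact (hC y hy).trans (le_max_left _ _)
      _ = _ := by ring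
  · filter_upwards [hF.ae_hasDerivAt, hG.ae_hasDerivAt] with x h1 h2 hx
    exact (h1 hx).inner ℂ (h2 hx)
  · have bound : ∀ {A B : ℝ → H}, IntervalIntegrable A volume p q → ContinuousOn B (Icc p q) →
        IntervalIntegrable (fun x => (inner ℂ (B x) (A x) : ℂ)) volume p q := by
      intro A B hA hB
      have hBm : AEStronglyMeasurable B (volume.restrict (uIoc p q)) := by
        rw [uIoc_of_le hpq]
        exact (hB.mono Ioc_subset_Icc_self).aestronglyMeasurable measurableSet_Ioc
      obtain ⟨C, hC⟩ := isCompact_Icc.exists_bound_of_continuousOn hB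
      rw [intervalIntegrable_iff] at hA ⊢
      refine (hA.norm.const_mul C).mono' (hBm.inner hA.1) ?_
      filter_upwards [ae_restrict_mem measurableSet_uIoc] with x hx
      rw [uIoc_of_le hpq] at hx
      exact (norm_inner_le_norm _ _).trans
        (mul_le_mul_of_nonneg_right (hC x (Ioc_subset_Icc_self hx)) (norm_nonneg _))
    refine (bound hG.1 (hF.continuousOn hpq)).add ?_
    -- This bounds ⟨G, F'⟩; the required ⟨F', G⟩ is its conjugate.
    have h2 := bound hF.1 (hG.continuousOn hpq)
    rw [intervalIntegrable_iff] at h2 ⊢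
    refine (Complex.conjCLE.toContinuousLinearMap.integrable_comp h2).congr ?_
    filter_upwards with x
    simp

/-- The gauge factor. As a is only integrable, the factor is merely absolutely continuous, through
|exp(iu) − exp(iv)| ≤ |u − v|. -/
theorem isPrimitive_exp {a : ℝ → ℝ} {q : ℝ} (hq : 0 ≤ q) (ha : IntervalIntegrable a volume 0 q) :
    IsPrimitive (fun x => Complex.exp ((∫ t in (0 : ℝ)..x, a t : ℝ) * Complex.I))
      (fun x => Complex.exp ((∫ t in (0 : ℝ)..x, a t : ℝ) * Complex.I) * (a x * Complex.I)) 0 q := by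
  have hA : IsPrimitive (fun x => ∫ t in (0 : ℝ)..x, a t) a 0 q := ⟨ha, fun x _ => by simp⟩
  have hac := hA.absolutelyContinuous hq
  refine isPrimitive_of_ae_hasDerivAt hq ?_ ?_ ?_
  · refine absolutelyContinuousOnInterval_of_dist_le (C := 1) hac hac fun x _ y _ => ?_
    set u := ∫ t in (0 : ℝ)..x, a t
    set v := ∫ t in (0 : ℝ)..y, a t
    have h1 : Complex.exp (u * Complex.I) - Complex.exp (v * Complex.I) =
        Complex.exp (v * Complex.I) * (Complex.exp (Complex.I * ((u - v : ℝ) : ℂ)) - 1) := by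
      rw [mul_sub, ← Complex.exp_add]; push_cast; ring_nf
    rw [dist_eq_norm, h1, norm_mul, Complex.norm_exp_ofReal_mul_I, one_mul, one_mul]
    have := Real.norm_exp_I_mul_ofReal_sub_one_le (x := u - v)
    rw [Real.dist_eq]
    rw [Real.norm_eq_abs] at this
    linarith [abs_nonneg (u - v)]
  · filter_upwards [hA.ae_hasDerivAt] with x hx hxI
    exact (((hx hxI).ofReal_comp).mul_const Complex.I).cexp
  · have hc : ContinuousOn (fun x => Complex.exp ((∫ t in (0 : ℝ)..x, a t : ℝ) * Complex.I))
        (uIcc 0 q) := by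
      have := hac.continuousOn
      fun_prop
    have h2 : IntervalIntegrable (fun x => (a x : ℂ) * Complex.I) volume 0 q := by
      rw [intervalIntegrable_iff] at ha ⊢
      exact (Integrable.ofReal (𝕜 := ℂ) ha).mul_const _
    exact h2.continuousOn_mul hc

end AbsolutelyContinuous

/-! ### The magnetic interpolation inequality -/

section Interpolation

variable {H : Type*} [NormedAddCommGroup H] [InnerProductSpace ℂ H] [CompleteSpace H]

theorem K_nonneg (α : ℝ) : 0 ≤ K α := by
  unfold K; split_ifs <;> positivity

theorem sin_two_pi_fract (α : ℝ) : sin (2 * π * Int.fract α) = sin (2 * π * α) := by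
  have : 2 * π * α = 2 * π * Int.fract α + ⌊α⌋ * (2 * π) := by
    have := Int.floor_add_fract α
    linear_combination -(2 * π) * this
  rw [this, Real.sin_add_int_mul_two_pi]

theorem cos_two_pi_fract (α : ℝ) : cos (2 * π * Int.fract α) = cos (2 * π * α) := by
  have : 2 * π * α = 2 * π * Int.fract α + ⌊α⌋ * (2 * π) := by
    have := Int.floor_add_fract α
    linear_combination -(2 * π) * this
  rw [this, Real.cos_add_int_mul_two_pi]

theorem sin_two_pi_mul_ne_zero {α : ℝ} (hα : ∀ n : ℤ, α ≠ n)
    (h : Int.fract α ∉ Icc (1 / 4 : ℝ) (3 / 4)) : sin (2 * π * α) ≠ 0 := by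
  rw [← sin_two_pi_fract]
  have h0 : 0 < Int.fract α := Int.fract_pos.2 fun h => hα _ h
  have h1 := Int.fract_lt_one α
  have hpi := Real.pi_pos
  rw [mem_Icc, not_and_or, not_le, not_le] at h
  rcases h with h | h
  · exact (Real.sin_pos_of_pos_of_lt_pi (by positivity) (by nlinarith)).ne'
  · rw [← Real.sin_sub_two_pi]
    exact (Real.sin_neg_of_neg_of_neg_pi_lt (by nlinarith) (by nlinarith)).ne

/-- 1/K(α) is the distance from exp(2πiα) to the ray [0, ∞). If the cosine is nonpositive, the
nearest point is 0 and the cross term has a good sign; otherwise the imaginary part gives the bound.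
-/
theorem le_K_mul_norm {α : ℝ} (hα : ∀ n : ℤ, α ≠ n) {r s : ℝ} (hr : 0 ≤ r) (hs : 0 ≤ s) :
    r ≤ K α * ‖Complex.exp ((2 * π * α : ℝ) * Complex.I) * r - s‖ := by
  set z := Complex.exp ((2 * π * α : ℝ) * Complex.I) * r - s with hz
  have hre : z.re = cos (2 * π * α) * r - s := by
    simp [hz, Complex.exp_ofReal_mul_I_re, Complex.mul_re, -Complex.ofReal_mul]
  have him : z.im = sin (2 * π * α) * r := by
    simp [hz, Complex.exp_ofReal_mul_I_im, Complex.mul_im, -Complex.ofReal_mul]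
  unfold K
  split_ifs with h
  · have hpi := Real.pi_pos
    have hc : cos (2 * π * α) ≤ 0 := by
      rw [← cos_two_pi_fract]
      exact Real.cos_nonpos_of_pi_div_two_le_of_le (by nlinarith [h.1]) (by nlinarith [h.2])
    rw [one_mul]
    refine le_of_sq_le_sq ?_ (norm_nonneg _)
    rw [Complex.sq_norm, Complex.normSq_apply, hre, him]
    nlinarith [Real.sin_sq_add_cos_sq (2 * π * α), mul_nonneg hr hs, sq_nonneg s,
      mul_nonneg (mul_nonneg hr hs) (neg_nonneg.2 hc)]
  · have hne := sin_two_pi_mul_ne_zero hα h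
    have := Complex.abs_im_le_norm z
    rw [him, abs_mul, abs_of_nonneg hr] at this
    rw [inv_mul_eq_div, le_div_iff₀ (abs_pos.2 hne), mul_comm]
    exact this

theorem integral_norm_mul_norm_le {E : Type*} [NormedAddCommGroup E] {μ : Measure ℝ}
    {f g : ℝ → E} (hf : MemLp f 2 μ) (hg : MemLp g 2 μ) :
    ∫ x, ‖f x‖ * ‖g x‖ ∂μ ≤ √(∫ x, ‖f x‖ ^ 2 ∂μ) * √(∫ x, ‖g x‖ ^ 2 ∂μ) := by
  have := integral_mul_le_Lp_mul_Lq_of_nonneg (μ := μ) (f := fun x => ‖f x‖) (g := fun x => ‖g x‖)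
    Real.HolderConjugate.two_two (.of_forall fun _ => norm_nonneg _)
    (.of_forall fun _ => norm_nonneg _) (by simpa using hf.norm) (by simpa using hg.norm)
  simpa [Real.sqrt_eq_rpow] using this

/-- Pairing `w` with its reflection: `|θ |w(0)|² - |w(q)|²| ≤ ‖w‖ ‖w'‖` on `[0, 2q]` if
`w(2q) = θ w(0)`. -/
theorem norm_twist_sub_le {w w' : ℝ → H} {q : ℝ} (hq : 0 ≤ q) {θ : ℂ}
    (h : IsPrimitive w w' 0 (2 * q)) (hθ : w (2 * q) = θ • w 0)
    (h2 : MemLp w' 2 (volume.restrict (Ioc 0 (2 * q)))) :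
    ‖θ * (‖w 0‖ ^ 2 : ℝ) - (‖w q‖ ^ 2 : ℝ)‖ ≤
      √(∫ x in (0 : ℝ)..(2 * q), ‖w x‖ ^ 2) * √(∫ x in (0 : ℝ)..(2 * q), ‖w' x‖ ^ 2) := by
  have hq2 : 0 ≤ 2 * q := by linarith
  have hP := (h.inner_apply hq2 h.reflect)
  have hd := hP.sub_eq (left_mem_Icc.2 hq2) (⟨hq, by linarith⟩ : q ∈ Icc 0 (2 * q))
  have hr := h.reflect.continuousOn hq2
  have hw := h.continuousOn hq2
  have hmemc : ∀ {u : ℝ → H}, ContinuousOn u (Icc 0 (2 * q)) →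
      MemLp u 2 (volume.restrict (Ioc 0 (2 * q))) := by
    intro u hu
    obtain ⟨C, hC⟩ := isCompact_Icc.exists_bound_of_continuousOn hu
    refine MemLp.of_bound
      ((hu.mono Ioc_subset_Icc_self).aestronglyMeasurable measurableSet_Ioc) C ?_
    filter_upwards [ae_restrict_mem measurableSet_Ioc] with x hx
    exact hC x (Ioc_subset_Icc_self hx)
  set g : ℝ → ℝ := fun x => ‖w (2 * q - x)‖ * ‖w' x‖ with hg
  have hgi : IntervalIntegrable g volume 0 (2 * q) := by
    rw [intervalIntegrable_iff, uIoc_of_le hq2]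
    exact (hmemc hr).norm.integrable_mul h2.norm
  have hsub : ∀ {a b : ℝ}, 0 ≤ a → a ≤ b → b ≤ 2 * q → IntervalIntegrable g volume a b := by
    intro a b ha hab hb
    refine hgi.mono_set ?_
    rw [uIcc_of_le hab, uIcc_of_le hq2]
    exact Icc_subset_Icc ha hb
  have key : ‖θ * (‖w 0‖ ^ 2 : ℝ) - (‖w q‖ ^ 2 : ℝ)‖ ≤ ∫ x in (0 : ℝ)..(2 * q), g x := by
    have e1 : inner ℂ (w q) (w (2 * q - q)) - inner ℂ (w 0) (w (2 * q - 0)) =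
        -(θ * (‖w 0‖ ^ 2 : ℝ) - (‖w q‖ ^ 2 : ℝ)) := by
      rw [sub_zero, hθ, inner_smul_right, two_mul, add_sub_cancel_right,
        inner_self_eq_norm_sq_to_K, inner_self_eq_norm_sq_to_K]
      push_cast
      simp
    -- Folding the second half onto the first: the two product-rule terms are bounded by `g x` and
    -- `g (2 * q - x)`, which together make up the integral of `g` over the whole interval.
    have e2 : ∫ x in q..(2 * q), g x = ∫ x in (0 : ℝ)..q, g (2 * q - x) := by
      rw [intervalIntegral.integral_comp_sub_left g (2 * q)]
      congr 1 <;> ring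
    have hgr : IntervalIntegrable (fun x => g (2 * q - x)) volume 0 q := by
      have := ((hsub hq (by linarith) le_rfl).comp_sub_left (2 * q)).symm
      have e : 2 * q - q = q := by ring
      simpa [e] using this
    rw [← norm_neg, ← e1, hd, ← intervalIntegral.integral_add_adjacent_intervals
      (hsub le_rfl hq (by linarith)) (hsub hq (by linarith) le_rfl), e2,
      ← intervalIntegral.integral_add (hsub le_rfl hq (by linarith)) hgr]
    refine intervalIntegral.norm_integral_le_of_norm_le hq (.of_forall fun x _ => ?_)
      ((hsub le_rfl hq (by linarith)).add hgr)
    refine (norm_add_le _ _).trans ?_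
    rw [add_comm]
    refine add_le_add ((norm_inner_le_norm _ _).trans_eq (mul_comm _ _))
      ((norm_inner_le_norm _ _).trans_eq ?_)
    simp [hg]
  refine key.trans ?_
  have e3 : ∫ x in (0 : ℝ)..(2 * q), ‖w x‖ ^ 2 = ∫ x in (0 : ℝ)..(2 * q), ‖w (2 * q - x)‖ ^ 2 := by
    rw [intervalIntegral.integral_comp_sub_left (fun x => ‖w x‖ ^ 2) (2 * q)]
    simp
  rw [e3]
  simp only [intervalIntegral.integral_of_le hq2]
  exact integral_norm_mul_norm_le (hmemc hr) h2

variable {E : Type*} [NormedAddCommGroup E]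

/-- The window `[x, x + q]` of a function on `[0, q]` continued by a second function. -/
noncomputable def window (x q : ℝ) (h k : ℝ → E) (s : ℝ) : E :=
  if s ≤ q - x then h (x + s) else k (x + s - q)

theorem intervalIntegrable_window {x q : ℝ} (hx : x ∈ Icc 0 q) {h k : ℝ → E}
    (hh : IntervalIntegrable h volume 0 q) (hk : IntervalIntegrable k volume 0 q) :
    IntervalIntegrable (window x q h k) volume 0 (q - x) ∧
    IntervalIntegrable (window x q h k) volume (q - x) q := by
  have hq : 0 ≤ q := hx.1.trans hx.2
  constructor
  · have := (hh.mono_set (c := x) (d := q) (by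
      rw [uIcc_of_le hx.2, uIcc_of_le hq]; exact Icc_subset_Icc_left hx.1)).comp_add_left x
    rw [sub_self] at this
    refine this.congr ?_
    intro s hs
    rw [uIoc_of_le (by linarith [hx.2])] at hs
    simp [window, hs.2]
  · have := (hk.mono_set (c := 0) (d := x) (by
      rw [uIcc_of_le hx.1, uIcc_of_le hq]; exact Icc_subset_Icc_right hx.2)).comp_add_left (x - q)
    rw [sub_sub_cancel, zero_sub, neg_sub] at this
    refine this.congr ?_
    intro s hs
    rw [uIoc_of_le (by linarith [hx.1])] at hs
    simp only [window, not_le.2 hs.1, if_false]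
    congr 1; ring

variable [NormedSpace ℝ E]

theorem integral_window_left {x q s : ℝ} (hs : s ∈ Icc 0 (q - x)) (h k : ℝ → E) :
    ∫ t in (0 : ℝ)..s, window x q h k t = ∫ t in x..(x + s), h t := by
  rw [show ∫ t in x..(x + s), h t = ∫ t in (x + 0)..(x + s), h t by rw [add_zero],
    ← intervalIntegral.integral_comp_add_left]
  refine intervalIntegral.integral_congr_ae (.of_forall fun t ht => ?_)
  rw [uIoc_of_le hs.1] at ht
  simp [window, ht.2.trans hs.2]

theorem integral_window_right {x q s : ℝ} (hs : s ∈ Icc (q - x) q) (h k : ℝ → E) :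
    ∫ t in (q - x)..s, window x q h k t = ∫ t in (0 : ℝ)..(x + s - q), k t := by
  have := intervalIntegral.integral_comp_add_left (a := q - x) (b := s) k (x - q)
  rw [show x - q + (q - x) = 0 by ring, show x - q + s = x + s - q by ring] at this
  rw [← this]
  refine intervalIntegral.integral_congr_ae (.of_forall fun t ht => ?_)
  rw [uIoc_of_le hs.1] at ht
  simp only [window, not_le.2 ht.1, if_false]
  congr 1; ring

theorem integral_window {x q : ℝ} (hx : x ∈ Icc 0 q) {h k : ℝ → E}
    (hh : IntervalIntegrable h volume 0 q) (hk : IntervalIntegrable k volume 0 q) :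
    ∫ t in (0 : ℝ)..q, window x q h k t = (∫ t in x..q, h t) + ∫ t in (0 : ℝ)..x, k t := by
  obtain ⟨h1, h2⟩ := intervalIntegrable_window hx hh hk
  rw [← intervalIntegral.integral_add_adjacent_intervals h1 h2,
    integral_window_left ⟨by linarith [hx.2], le_rfl⟩, integral_window_right
    ⟨by linarith [hx.1], le_rfl⟩]
  congr 2 <;> ring

/-- The matching condition `w q = k 0` excludes a jump at the junction. -/
theorem IsPrimitive.window {w w' k k' : ℝ → E} {x q : ℝ} (hx : x ∈ Icc 0 q)
    (hw : IsPrimitive w w' 0 q) (hk : IsPrimitive k k' 0 q) (hwk : w q = k 0) :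
    IsPrimitive (window x q w k) (window x q w' k') 0 q := by
  have hq : 0 ≤ q := hx.1.trans hx.2
  obtain ⟨h1, h2⟩ := intervalIntegrable_window hx hw.1 hk.1
  refine ⟨h1.trans h2, fun s hs => ?_⟩
  have h0 : MagneticLT.window x q w k 0 = w x := by simp [MagneticLT.window, hx.2]
  rw [h0]
  by_cases hsx : s ≤ q - x
  · rw [integral_window_left ⟨hs.1, hsx⟩, ← hw.sub_eq hx ⟨by linarith [hx.1, hs.1], by linarith⟩]
    simp [MagneticLT.window, hsx]
  · push Not at hsx
    have h3 := h2.mono_set (c := q - x) (d := s) (by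
      rw [uIcc_of_le hsx.le, uIcc_of_le (by linarith [hx.1])]; exact Icc_subset_Icc_right hs.2)
    rw [← intervalIntegral.integral_add_adjacent_intervals h1 h3,
      integral_window_left ⟨by linarith [hx.2], le_rfl⟩, integral_window_right ⟨hsx.le, hs.2⟩,
      ← hw.sub_eq hx ⟨by linarith [hx.1, hx.2], by linarith⟩,
      ← hk.sub_eq (left_mem_Icc.2 hq) ⟨by linarith, by linarith [hx.2, hs.2]⟩,
      add_sub_cancel, hwk]
    simp [MagneticLT.window, not_le.2 hsx]

/-- The reflection estimate only sees the left endpoint and the midpoint. Continuing w by θw and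
reading it on [x, x + 2π] makes x the left endpoint; as |θ| = 1, both L² norms and the twist are
unchanged. The midpoint value drops out because `le_K_mul_norm` holds for every s ≥ 0. -/
theorem norm_sq_le_of_twist {w w' : ℝ → H} {α : ℝ} (hα : ∀ n : ℤ, α ≠ n)
    (h : IsPrimitive w w' 0 (2 * π))
    (hθ : w (2 * π) = Complex.exp ((2 * π * α : ℝ) * Complex.I) • w 0)
    (h2 : MemLp w' 2 circleMeasure) {x : ℝ} (hx : x ∈ Icc 0 (2 * π)) :
    ‖w x‖ ^ 2 ≤ K α * (√(∫ x in (0 : ℝ)..(2 * π), ‖w x‖ ^ 2) *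
      √(∫ x in (0 : ℝ)..(2 * π), ‖w' x‖ ^ 2)) := by
  set θ := Complex.exp ((2 * π * α : ℝ) * Complex.I) with hθdef
  have hθ1 : ‖θ‖ = 1 := Complex.norm_exp_ofReal_mul_I _
  have hpi := Real.pi_pos
  have hpi2 : (0 : ℝ) ≤ 2 * π := by positivity
  have hθw : IsPrimitive (fun s => θ • w s) (fun s => θ • w' s) 0 (2 * π) := by
    refine ⟨h.1.smul θ, fun y hy => ?_⟩
    simp only [intervalIntegral.integral_smul]
    rw [h.2 y hy, smul_add]
  have hW := IsPrimitive.window hx h hθw hθ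
  have hWn : ∀ (v : ℝ → H) s, ‖window x (2 * π) v (fun s => θ • v s) s‖ ^ 2 =
      window x (2 * π) (fun s => ‖v s‖ ^ 2) (fun s => ‖v s‖ ^ 2) s := by
    intro v s
    unfold window
    split_ifs <;> simp [norm_smul, hθ1]
  have hi : ∀ {v : ℝ → H}, IntervalIntegrable (fun s => ‖v s‖ ^ 2) volume 0 (2 * π) →
      ∫ s in (0 : ℝ)..(2 * π), ‖window x (2 * π) v (fun s => θ • v s) s‖ ^ 2 =
      ∫ s in (0 : ℝ)..(2 * π), ‖v s‖ ^ 2 := by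
    intro v hv
    simp only [hWn]
    rw [integral_window hx hv hv, add_comm]
    refine intervalIntegral.integral_add_adjacent_intervals (hv.mono_set ?_) (hv.mono_set ?_)
    · rw [uIcc_of_le hx.1, uIcc_of_le hpi2]; exact Icc_subset_Icc_right hx.2
    · rw [uIcc_of_le hx.2, uIcc_of_le hpi2]; exact Icc_subset_Icc_left hx.1
  have hv1 : IntervalIntegrable (fun s => ‖w s‖ ^ 2) volume 0 (2 * π) := by
    refine ContinuousOn.intervalIntegrable ?_
    rw [uIcc_of_le hpi2]
    exact (h.continuousOn hpi2).norm.pow 2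
  have hv2 : IntervalIntegrable (fun s => ‖w' s‖ ^ 2) volume 0 (2 * π) := by
    rw [intervalIntegrable_iff, uIoc_of_le hpi2]
    exact h2.integrable_norm_pow (by norm_num)
  have hW2 : MemLp (window x (2 * π) w' (fun s => θ • w' s)) 2 circleMeasure := by
    rw [memLp_two_iff_integrable_sq_norm]
    · simp only [hWn]
      obtain ⟨i1, i2⟩ := intervalIntegrable_window hx hv2 hv2
      have := i1.trans i2
      rwa [intervalIntegrable_iff, uIoc_of_le hpi2] at this
    · have := hW.1
      rw [intervalIntegrable_iff, uIoc_of_le hpi2] at this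
      exact this.1
  have hend : window x (2 * π) w (fun s => θ • w s) (2 * π) =
      θ • window x (2 * π) w (fun s => θ • w s) 0 := by
    have h0 : window x (2 * π) w (fun s => θ • w s) 0 = w x := by simp [window, hx.2]
    rw [h0]
    unfold window
    split_ifs with hc
    -- At s = 2π the first branch of `window` can only occur for x = 0.
    · have : x = 0 := le_antisymm (by linarith) hx.1
      rw [this, zero_add, hθ]
    · simp
  have hfin := norm_twist_sub_le hpi.le hW hend hW2
  rw [hi hv1, hi hv2] at hfin
  have h0 : window x (2 * π) w (fun s => θ • w s) 0 = w x := by simp [window, hx.2]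
  rw [h0] at hfin
  exact (le_K_mul_norm hα (sq_nonneg ‖w x‖) (sq_nonneg _)).trans
    (mul_le_mul_of_nonneg_left hfin (K_nonneg α))

/-- The magnetic interpolation inequality on the circle. -/
theorem norm_sq_le_of_flux {f f' : ℝ → H} {a : ℝ → ℝ} {α : ℝ} (hα : ∀ n : ℤ, α ≠ n)
    (ha : IntervalIntegrable a volume 0 (2 * π)) (hflux : flux a = α)
    (h : IsPrimitive f f' 0 (2 * π)) (hper : f 0 = f (2 * π))
    (h2 : MemLp (fun x => Complex.I • f' x - (a x : ℂ) • f x) 2 circleMeasure)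
    {x : ℝ} (hx : x ∈ Icc 0 (2 * π)) :
    ‖f x‖ ^ 2 ≤ K α * (√(∫ x, ‖f x‖ ^ 2 ∂circleMeasure) *
      √(∫ x, ‖Complex.I • f' x - (a x : ℂ) • f x‖ ^ 2 ∂circleMeasure)) := by
  have hpi2 : (0 : ℝ) ≤ 2 * π := by positivity
  set e : ℝ → ℂ := fun x => Complex.exp ((∫ t in (0 : ℝ)..x, a t : ℝ) * Complex.I) with he
  have hen : ∀ x, ‖e x‖ = 1 := fun x => Complex.norm_exp_ofReal_mul_I _
  have hw := (isPrimitive_exp hpi2 ha).smul hpi2 h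
  -- The derivative of the gauged function is the magnetic derivative of `f` times a unimodular
  -- factor, so a survives only in the twist.
  have hw' : ∀ x, e x • f' x + (e x * (a x * Complex.I)) • f x =
      (e x * -Complex.I) • (Complex.I • f' x - (a x : ℂ) • f x) := by
    intro x
    rw [smul_sub, smul_smul, smul_smul, sub_eq_add_neg, ← neg_smul]
    congr 2
    · rw [mul_assoc, neg_mul, Complex.I_mul_I]; simp
    · ring
  have hnorm : ∀ x, ‖e x • f' x + (e x * (a x * Complex.I)) • f x‖ =
      ‖Complex.I • f' x - (a x : ℂ) • f x‖ := by
    intro x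
    rw [hw', norm_smul]
    simp [hen]
  have hA : ∫ t in (0 : ℝ)..(2 * π), a t = 2 * π * α := by
    rw [← hflux, flux]
    field_simp
  have := norm_sq_le_of_twist hα hw (by
    simp only [intervalIntegral.integral_same, Complex.ofReal_zero, zero_mul, Complex.exp_zero,
      one_smul, hA, hper]) (h2.of_le (by
        have := hw.1
        rw [intervalIntegrable_iff, uIoc_of_le hpi2] at this
        exact this.1) (.of_forall fun x => (hnorm x).le)) hx
  change ‖e x • f x‖ ^ 2 ≤ K α * (√(∫ x in (0 : ℝ)..(2 * π), ‖e x • f x‖ ^ 2) *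
    √(∫ x in (0 : ℝ)..(2 * π), ‖e x • f' x + (e x * (a x * Complex.I)) • f x‖ ^ 2)) at this
  simp only [hnorm, norm_smul, hen, one_mul, intervalIntegral.integral_of_le hpi2] at this
  exact this

end Interpolation

/-! ### Pointwise matrix inequalities -/

theorem K_pos {α : ℝ} (hα : ∀ n : ℤ, α ≠ n) : 0 < K α := by
  unfold K
  split_ifs with h
  · exact one_pos
  · exact inv_pos.2 (abs_pos.2 (sin_two_pi_mul_ne_zero hα h))

/-- For s ≥ 0 the maximum of s m − m³/κ² over m ≥ 0 is attained at m = κ√(s/3); its value produces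
the constant 2/(3√3). After scaling, the claim is (n − q)²(n + 2q) ≥ 0. -/
theorem mul_le_rpow_add_cube {κ s m : ℝ} (hκ : 0 < κ) (hm : 0 ≤ m) :
    s * m ≤ 2 / (3 * √3) * κ * (max s 0) ^ (3 / 2 : ℝ) + m ^ 3 / κ ^ 2 := by
  have h3 : 0 < √3 := by positivity
  have h33 : √3 ^ 2 = 3 := Real.sq_sqrt (by norm_num)
  have hp0 := Real.sqrt_nonneg (max s 0)
  have hp2 : √(max s 0) ^ 2 = max s 0 := Real.sq_sqrt (le_max_right _ _)
  have hp3 : (max s 0) ^ (3 / 2 : ℝ) = √(max s 0) ^ 3 := by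
    rw [Real.sqrt_eq_rpow, ← Real.rpow_natCast, ← Real.rpow_mul (le_max_right _ _)]
    norm_num
  rw [hp3]
  generalize √(max s 0) = p at *
  have hle : s * m ≤ p ^ 2 * m := by
    rw [hp2]; exact mul_le_mul_of_nonneg_right (le_max_left _ _) hm
  refine hle.trans ?_
  obtain ⟨q, rfl⟩ : ∃ q, p = √3 * q := ⟨p / √3, by field_simp⟩
  obtain ⟨n, rfl⟩ : ∃ n, m = κ * n := ⟨m / κ, by field_simp⟩
  have hq : 0 ≤ q := nonneg_of_mul_nonneg_right hp0 h3
  have hn : 0 ≤ n := nonneg_of_mul_nonneg_right hm hκ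
  have e1 : 2 / (3 * √3) * κ * (√3 * q) ^ 3 + (κ * n) ^ 3 / κ ^ 2 = κ * (2 * q ^ 3 + n ^ 3) := by
    field_simp
    rw [h33]; ring
  have e2 : (√3 * q) ^ 2 * (κ * n) = κ * (3 * q ^ 2 * n) := by
    rw [mul_pow, h33]; ring
  rw [e1, e2]
  refine mul_le_mul_of_nonneg_left ?_ hκ.le
  nlinarith [mul_nonneg (sq_nonneg (n - q)) (by linarith : 0 ≤ n + 2 * q)]

section Pointwise

variable {M : ℕ} {ι G : Type*} [Fintype ι] [NormedAddCommGroup G] [InnerProductSpace ℂ G]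

/-- Diagonal entries `⟨e, U e⟩` of `U = ∑ |y i⟩⟨y i|`, cubed and summed over an orthonormal basis. -/
theorem sum_cube_le {N : Type*} [Fintype N] {κ : ℝ}
    (e : OrthonormalBasis N ℂ (Fibre M)) (y : ι → Fibre M) (g : ι → G)
    (h : ∀ ξ : ι → ℂ, ‖∑ i, ξ i • y i‖ ^ 2 ≤ κ * (√(∑ i, ‖ξ i‖ ^ 2) * ‖∑ i, ξ i • g i‖)) :
    ∑ k, (∑ i, ‖inner ℂ (e k) (y i)‖ ^ 2) ^ 3 ≤
      κ ^ 2 * (∑ i, ∑ j, inner ℂ (y j) (y i) * inner ℂ (g i) (g j) : ℂ).re := by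
  -- These coefficients make both |ξ|² and ⟨e_k, ∑ ξ_i y_i⟩ equal to the diagonal entry m_k.
  set ξ : N → ι → ℂ := fun k i => inner ℂ (y i) (e k) with hξ
  set m : N → ℝ := fun k => ∑ i, ‖inner ℂ (e k) (y i)‖ ^ 2 with hm
  have hm0 : ∀ k, 0 ≤ m k := fun k => Finset.sum_nonneg fun _ _ => sq_nonneg _
  have hξm : ∀ k, ∑ i, ‖ξ k i‖ ^ 2 = m k := fun k =>
    Finset.sum_congr rfl fun i _ => by rw [hξ, norm_inner_symm]
  have hin : ∀ k, inner ℂ (e k) (∑ i, ξ k i • y i) = (m k : ℂ) := by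
    intro k
    rw [inner_sum]
    simp only [hm, Complex.ofReal_sum]
    refine Finset.sum_congr rfl fun i _ => ?_
    rw [inner_smul_right, hξ]
    simp only
    rw [← inner_conj_symm, Complex.conj_mul']
    push_cast; rfl
  -- Cauchy–Schwarz and the hypothesis give m_k² ≤ κ √m_k ‖∑ ξ_i g_i‖; square and divide by m_k.
  have hcube : ∀ k, m k ^ 3 ≤ κ ^ 2 * ‖∑ i, ξ k i • g i‖ ^ 2 := by
    intro k
    have h1 : m k ≤ ‖∑ i, ξ k i • y i‖ := by
      have := norm_inner_le_norm (𝕜 := ℂ) (e k) (∑ i, ξ k i • y i)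
      rw [hin, e.norm_eq_one, one_mul, Complex.norm_real, Real.norm_of_nonneg (hm0 k)] at this
      exact this
    have h2 := h (ξ k)
    rw [hξm] at h2
    have h3 : m k ^ 2 ≤ κ * (√(m k) * ‖∑ i, ξ k i • g i‖) :=
      (pow_le_pow_left₀ (hm0 k) h1 2).trans h2
    rcases (hm0 k).eq_or_lt with h0 | h0
    · rw [← h0, zero_pow (by norm_num)]; positivity
    · have h4 := pow_le_pow_left₀ (sq_nonneg _) h3 2
      have h5 : √(m k) ^ 2 = m k := Real.sq_sqrt h0.le
      refine le_of_mul_le_mul_left ?_ h0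
      calc m k * m k ^ 3 = (m k ^ 2) ^ 2 := by ring
        _ ≤ _ := h4
        _ = √(m k) ^ 2 * (κ ^ 2 * ‖∑ i, ξ k i • g i‖ ^ 2) := by ring
        _ = _ := by rw [h5]
  refine (Finset.sum_le_sum fun k _ => hcube k).trans_eq ?_
  rw [← Finset.mul_sum]
  congr 1
  -- Once the square is expanded, Parseval in k removes the basis and leaves the Gram matrix of y
  -- against that of g.
  have hG : ∀ k, ((‖∑ i, ξ k i • g i‖ ^ 2 : ℝ) : ℂ) =
      ∑ i, ∑ j, (inner ℂ (y j) (e k) * inner ℂ (e k) (y i)) * inner ℂ (g i) (g j) := by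
    intro k
    have := inner_self_eq_norm_sq_to_K (𝕜 := ℂ) (∑ i, ξ k i • g i)
    push_cast
    refine this.symm.trans ?_
    rw [sum_inner]
    refine Finset.sum_congr rfl fun i _ => ?_
    rw [inner_sum]
    refine Finset.sum_congr rfl fun j _ => ?_
    rw [inner_smul_left, inner_smul_right, hξ]
    simp only [inner_conj_symm]
    ring
  rw [← Complex.ofReal_re (∑ k, ‖∑ i, ξ k i • g i‖ ^ 2)]
  congr 1
  rw [Complex.ofReal_sum]
  simp only [hG]
  rw [Finset.sum_comm]
  refine Finset.sum_congr rfl fun i _ => ?_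
  rw [Finset.sum_comm]
  refine Finset.sum_congr rfl fun j _ => ?_
  rw [← Finset.sum_mul, e.sum_inner_mul_inner]

theorem trace_cfc_re {W : Matrix (Fin M) (Fin M) ℂ} (hW : W.IsHermitian) (f : ℝ → ℝ) :
    (Matrix.trace (cfc f W)).re = ∑ k, f (hW.eigenvalues k) := by
  rw [hW.cfc_eq, Matrix.IsHermitian.cfc, Unitary.conjStarAlgAut_apply, Matrix.trace_mul_comm,
    ← mul_assoc]
  simp [Matrix.trace_diagonal]

theorem inner_toEuclideanLin_re {W : Matrix (Fin M) (Fin M) ℂ} (hW : W.IsHermitian)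
    (y : Fibre M) : (inner ℂ y (Matrix.toEuclideanLin W y) : ℂ).re =
      ∑ k, hW.eigenvalues k * ‖inner ℂ (hW.eigenvectorBasis k) y‖ ^ 2 := by
  rw [← hW.eigenvectorBasis.sum_inner_mul_inner, Complex.re_sum]
  refine Finset.sum_congr rfl fun k _ => ?_
  have hs := Matrix.isSymmetric_toEuclideanLin_iff.2 hW
  have he : Matrix.toEuclideanLin W (hW.eigenvectorBasis k) =
      (hW.eigenvalues k : ℂ) • hW.eigenvectorBasis k := by
    rw [Matrix.toLpLin_apply, hW.mulVec_eigenvectorBasis]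
    ext i
    simp
  rw [← hs, he, inner_smul_left, Complex.conj_ofReal, mul_left_comm, ← inner_conj_symm,
    Complex.conj_mul']
  norm_cast

/-- Since the basis in `sum_cube_le` is free, eigenvectors of `W` can be used. They diagonalise the
potential term, and the scalar Young inequality applies to each eigenvalue; its cubic remainders are
exactly what the Gram term pays for. -/
theorem sum_form_le {κ t : ℝ} (hκ : 0 < κ) {W : Matrix (Fin M) (Fin M) ℂ} (hW : W.IsHermitian)
    (y : ι → Fibre M) (g : ι → G)
    (h : ∀ ξ : ι → ℂ, ‖∑ i, ξ i • y i‖ ^ 2 ≤ κ * (√(∑ i, ‖ξ i‖ ^ 2) * ‖∑ i, ξ i • g i‖)) :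
    ∑ i, ((inner ℂ (y i) (Matrix.toEuclideanLin W (y i)) : ℂ).re - t * ‖y i‖ ^ 2) -
      (∑ i, ∑ j, inner ℂ (y j) (y i) * inner ℂ (g i) (g j) : ℂ).re ≤
    2 / (3 * √3) * κ * (Matrix.trace (cfc (fun s : ℝ => (max (s - t) 0) ^ (3 / 2 : ℝ)) W)).re := by
  have hc := sum_cube_le hW.eigenvectorBasis y g h
  set m : Fin M → ℝ := fun k => ∑ i, ‖inner ℂ (hW.eigenvectorBasis k) (y i)‖ ^ 2 with hm
  have h1 : ∑ i, ((inner ℂ (y i) (Matrix.toEuclideanLin W (y i)) : ℂ).re - t * ‖y i‖ ^ 2) =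
      ∑ k, (hW.eigenvalues k - t) * m k := by
    simp only [hm, Finset.mul_sum]
    rw [Finset.sum_comm]
    refine Finset.sum_congr rfl fun i _ => ?_
    rw [inner_toEuclideanLin_re hW, ← hW.eigenvectorBasis.sum_sq_norm_inner_right,
      Finset.mul_sum, ← Finset.sum_sub_distrib]
    exact Finset.sum_congr rfl fun k _ => by ring
  rw [h1, trace_cfc_re hW, Finset.mul_sum, sub_le_iff_le_add]
  have h2 : ∑ k, (hW.eigenvalues k - t) * m k ≤
      ∑ k, (2 / (3 * √3) * κ * (max (hW.eigenvalues k - t) 0) ^ (3 / 2 : ℝ) + m k ^ 3 / κ ^ 2) :=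
    Finset.sum_le_sum fun k _ => mul_le_rpow_add_cube hκ
      (Finset.sum_nonneg fun _ _ => sq_nonneg _)
  refine h2.trans ?_
  rw [Finset.sum_add_distrib, ← Finset.sum_div]
  gcongr
  rw [div_le_iff₀ (by positivity), mul_comm]
  exact hc

end Pointwise

/-! ### Shifted eigenvalue sums -/

theorem Lp_norm_eq_sqrt {M : ℕ} {u : L2 M} {f : ℝ → Fibre M} (h : u =ᵐ[circleMeasure] f) :
    √(∫ x, ‖f x‖ ^ 2 ∂circleMeasure) = ‖u‖ := by
  have h1 : (inner ℂ u u : ℂ) = ((∫ x, ‖f x‖ ^ 2 ∂circleMeasure : ℝ) : ℂ) := by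
    rw [L2.inner_def, ← integral_complex_ofReal]
    refine integral_congr_ae ?_
    filter_upwards [h] with x hx
    rw [inner_self_eq_norm_sq_to_K, hx]
    push_cast; rfl
  have h2 := inner_self_eq_norm_sq (𝕜 := ℂ) u
  rw [h1] at h2
  rw [← Complex.ofReal_re (∫ x, ‖f x‖ ^ 2 ∂circleMeasure)]
  refine (congrArg Real.sqrt h2).trans ?_
  rw [ Real.sqrt_sq (norm_nonneg _)]

/-- Functions in the form domain have representatives whose linear combinations obey the
interpolation inequality at every point. -/
theorem exists_representatives {M : ℕ} {ι : Type*} [Fintype ι] {a : ℝ → ℝ} {α : ℝ}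
    (hα : ∀ n : ℤ, α ≠ n) (ha : IntervalIntegrable a volume 0 (2 * π)) (hflux : flux a = α)
    {u g : ι → L2 M} (hu : ∀ i, (u i, g i) ∈ magneticDeriv a) :
    ∃ f : ι → ℝ → Fibre M, (∀ i, u i =ᵐ[circleMeasure] f i) ∧
      ∀ x ∈ Icc 0 (2 * π), ∀ ξ : ι → ℂ,
        ‖∑ i, ξ i • f i x‖ ^ 2 ≤ K α * (‖∑ i, ξ i • u i‖ * ‖∑ i, ξ i • g i‖) := by
  choose f f' hi hf hp huf hgf using hu
  refine ⟨f, huf, fun x hx ξ => ?_⟩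
  have hpi2 : (0 : ℝ) ≤ 2 * π := by positivity
  have hsum : ∀ (v : ι → L2 M) (k : ι → ℝ → Fibre M), (∀ i, v i =ᵐ[circleMeasure] k i) →
      (∑ i, ξ i • v i : L2 M) =ᵐ[circleMeasure] fun x => ∑ i, ξ i • k i x := by
    intro v k hvk
    have h1 := Lp.coeFn_finsetSum Finset.univ (fun i => ξ i • v i)
    have h2 : ∀ᵐ x ∂circleMeasure, ∀ i, (ξ i • v i : L2 M) x = ξ i • v i x :=
      ae_all_iff.2 fun i => Lp.coeFn_smul _ _
    have h3 : ∀ᵐ x ∂circleMeasure, ∀ i, v i x = k i x := ae_all_iff.2 hvk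
    filter_upwards [h1, h2, h3] with x h1 h2 h3
    rw [h1]
    simp only [Finset.sum_apply, h2, h3]
  have hF : IsPrimitive (fun x => ∑ i, ξ i • f i x) (fun x => ∑ i, ξ i • f' i x) 0 (2 * π) := by
    refine ⟨?_, fun y hy => ?_⟩
    · have := IntervalIntegrable.sum (μ := volume) (a := 0) (b := 2 * π) Finset.univ
        (f := fun i x => ξ i • f' i x) fun i _ => (hi i).smul (ξ i)
      refine this.congr fun x _ => ?_
      simp
    · have hsub : uIcc (0 : ℝ) y ⊆ uIcc 0 (2 * π) := by
        rw [uIcc_of_le hy.1, uIcc_of_le (hy.1.trans hy.2)]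
        exact Icc_subset_Icc_right hy.2
      have hint := intervalIntegral.integral_finsetSum (s := Finset.univ)
        (f := fun i x => ξ i • f' i x) fun i _ => ((hi i).mono_set hsub).smul (ξ i)
      beta_reduce
      rw [hint, ← Finset.sum_add_distrib]
      refine Finset.sum_congr rfl fun i _ => ?_
      rw [intervalIntegral.integral_smul, hf i y hy, smul_add]
  have hD : (fun x => Complex.I • (∑ i, ξ i • f' i x) - (a x : ℂ) • ∑ i, ξ i • f i x) =
      fun x => ∑ i, ξ i • (Complex.I • f' i x - (a x : ℂ) • f i x) := by
    funext x
    rw [Finset.smul_sum, Finset.smul_sum, ← Finset.sum_sub_distrib]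
    refine Finset.sum_congr rfl fun i _ => ?_
    rw [smul_sub, smul_comm (ξ i), smul_comm (ξ i)]
  have hg := hsum g _ hgf
  rw [← hD] at hg
  have := norm_sq_le_of_flux hα ha hflux hF
    (Finset.sum_congr rfl fun i _ => by rw [hp i]) ((memLp_congr_ae hg).1 (Lp.memLp _)) hx
  rwa [Lp_norm_eq_sqrt (hsum u f huf), Lp_norm_eq_sqrt hg] at this

/-- Passing to the lower integral allows comparison with the trace term before its measurability or
integrability is known. -/
theorem ofReal_integral_le_lintegral {X : Type*} [MeasurableSpace X] {μ : Measure X} {h : X → ℝ}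
    (hi : Integrable h μ) : ENNReal.ofReal (∫ x, h x ∂μ) ≤ ∫⁻ x, ENNReal.ofReal (h x) ∂μ := by
  rw [integral_eq_lintegral_pos_part_sub_lintegral_neg_part hi]
  refine (ENNReal.ofReal_le_ofReal (sub_le_self _ ENNReal.toReal_nonneg)).trans ?_
  exact ENNReal.ofReal_toReal_le

/-- Bound for shifted sums over a finite orthonormal family of eigenfunctions. -/
theorem ofReal_sum_sub_le {M : ℕ} {ι : Type*} [Fintype ι] {a : ℝ → ℝ} {α : ℝ}
    (hα : ∀ n : ℤ, α ≠ n) (ha : IntervalIntegrable a volume 0 (2 * π)) (hflux : flux a = α)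
    {V : ℝ → Matrix (Fin M) (Fin M) ℂ} (hV : ∀ᵐ x ∂circleMeasure, (V x).IsHermitian)
    {u : ι → L2 M} (hu : Orthonormal ℂ u) {l : ι → ℝ} (hl : ∀ i, u i ∈ eigenspace a V (-l i))
    (t : ℝ) :
    ENNReal.ofReal (∑ i, (l i - t)) ≤ ∫⁻ x, ENNReal.ofReal (2 / (3 * √3) * K α *
      (Matrix.trace (cfc (fun s : ℝ => (max (s - t) 0) ^ (3 / 2 : ℝ)) (V x))).re)
      ∂circleMeasure := by
  classical
  choose g hg H using hl
  change ∀ i, (u i, g i) ∈ magneticDeriv a at hg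
  obtain ⟨f, huf, hf⟩ := exists_representatives hα ha hflux hg
  have hself := fun i => H i (u i) (g i) (hg i)
  set h : ℝ → ℝ := fun x =>
    ∑ i, ((potentialDensity V (u i) (u i) x).re - t * (inner ℂ (u i x) (u i x) : ℂ).re) -
      (∑ i, ∑ j, inner ℂ (u j x) (u i x) * inner ℂ (g i) (g j) : ℂ).re with hh
  have i1 : ∀ i, Integrable (fun x => (potentialDensity V (u i) (u i) x).re) circleMeasure :=
    fun i => (hself i).1.re
  have i2 : ∀ i, Integrable (fun x => t * (inner ℂ (u i x) (u i x) : ℂ).re) circleMeasure :=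
    fun i => ((L2.integrable_inner (𝕜 := ℂ) (u i) (u i)).re).const_mul t
  have i3 : ∀ i j, Integrable (fun x => (inner ℂ (u j x) (u i x) * inner ℂ (g i) (g j) : ℂ))
      circleMeasure := fun i j => (L2.integrable_inner (𝕜 := ℂ) (u j) (u i)).mul_const _
  have i4 : Integrable (fun x => ∑ i, ∑ j, (inner ℂ (u j x) (u i x) * inner ℂ (g i) (g j) : ℂ))
      circleMeasure := integrable_finsetSum _ fun i _ => integrable_finsetSum _ fun j _ => i3 i j
  have i5 : Integrable (fun x => ∑ i, ((potentialDensity V (u i) (u i) x).re -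
      t * (inner ℂ (u i x) (u i x) : ℂ).re)) circleMeasure :=
    integrable_finsetSum _ fun i _ => (i1 i).sub (i2 i)
  -- Each eigenvalue equation is tested with its own eigenfunction, giving ‖g_i‖² − ∫⟨u_i, V u_i⟩ =
  -- −l_i. Orthonormality removes the off-diagonal Gram terms.
  have hint : ∫ x, h x ∂circleMeasure = ∑ i, (l i - t) := by
    have e4 : ∫ x, (∑ i, ∑ j, (inner ℂ (u j x) (u i x) * inner ℂ (g i) (g j) : ℂ)).re
        ∂circleMeasure = ∑ i, (inner ℂ (g i) (g i) : ℂ).re := by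
      have e := integral_re i4
      refine e.trans ?_
      rw [integral_finsetSum _ fun i _ => integrable_finsetSum _ fun j _ => i3 i j]
      rw [map_sum]
      refine Finset.sum_congr rfl fun i _ => ?_
      rw [integral_finsetSum _ fun j _ => i3 i j]
      have : ∀ j, ∫ x, (inner ℂ (u j x) (u i x) * inner ℂ (g i) (g j) : ℂ) ∂circleMeasure =
          if j = i then inner ℂ (g i) (g j) else 0 := by
        intro j
        rw [integral_mul_const, ← L2.inner_def, orthonormal_iff_ite.1 hu]
        split_ifs <;> simp
      simp [this]
    refine (integral_sub i5 i4.re).trans ((congrArg₂ (· - ·)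
      (integral_finsetSum _ fun i _ => (i1 i).sub (i2 i)) e4).trans ?_)
    rw [← Finset.sum_sub_distrib]
    refine Finset.sum_congr rfl fun i _ => ?_
    have e1 : ∫ x, (potentialDensity V (u i) (u i) x).re ∂circleMeasure =
        (∫ x, potentialDensity V (u i) (u i) x ∂circleMeasure).re := integral_re (hself i).1
    have e2 : ∫ x, (inner ℂ (u i x) (u i x) : ℂ).re ∂circleMeasure = 1 := by
      have := integral_re (L2.integrable_inner (𝕜 := ℂ) (u i) (u i))
      refine this.trans ?_
      rw [← L2.inner_def, orthonormal_iff_ite.1 hu]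
      simp
    rw [integral_sub' (i1 i) (i2 i), e1, integral_const_mul, e2]
    have e3 := congrArg Complex.re (hself i).2
    have e5 : (inner ℂ (u i) (u i) : ℂ) = 1 := by rw [orthonormal_iff_ite.1 hu]; simp
    simp only [LinearMap.prod_apply, Function.prod_apply, LinearMap.id_apply, LinearMap.smul_apply,
      inner_smul_right, e5, Complex.sub_re, mul_one, Complex.ofReal_re] at e3
    linarith
  rw [← hint]
  refine (ofReal_integral_le_lintegral (i5.sub i4.re)).trans (lintegral_mono_ae ?_)
  have hall : ∀ᵐ x ∂circleMeasure, ∀ i, u i x = f i x := ae_all_iff.2 huf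
  filter_upwards [hall, hV, ae_restrict_mem measurableSet_Ioc] with x hx hVx hxI
  refine ENNReal.ofReal_le_ofReal ?_
  have := sum_form_le (t := t) (K_pos hα) hVx (fun i => u i x) g (fun ξ => by
    have h1 := hf x (Ioc_subset_Icc_self hxI) ξ
    have h2 : ‖∑ i, ξ i • u i‖ = √(∑ i, ‖ξ i‖ ^ 2) := by
      have h3 := hu.inner_sum ξ ξ Finset.univ
      simp only [Complex.conj_mul'] at h3
      have h4 : ‖∑ i, ξ i • u i‖ ^ 2 = ∑ i, ‖ξ i‖ ^ 2 := by
        rw [← inner_self_eq_norm_sq (𝕜 := ℂ), h3]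
        have : (∑ i, (‖ξ i‖ : ℂ) ^ 2) = ((∑ i, ‖ξ i‖ ^ 2 : ℝ) : ℂ) := by push_cast; rfl
        rw [this]
        exact Complex.ofReal_re _
      rw [← h4, Real.sqrt_sq (norm_nonneg _)]
    rw [h2] at h1
    simpa only [hx] using h1)
  refine le_trans (le_of_eq ?_) this
  have e6 : ∀ i, (inner ℂ (u i x) (u i x) : ℂ).re = ‖u i x‖ ^ 2 := fun i =>
    inner_self_eq_norm_sq (𝕜 := ℂ) (u i x)
  simp only [Pi.sub_apply, RCLike.re_to_complex, e6, potentialDensity]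

/-! ### Aizenman–Lieb lifting and the semiclassical constants -/

section SemiclassicalConstant

/-- The weight of the Aizenman–Lieb representation `λ^γ = ∫₀^∞ γ(γ-1) t^(γ-2) (λ - t)₊ dt`. -/
noncomputable def rieszWeight (γ t : ℝ) : ℝ≥0∞ := ENNReal.ofReal (γ * (γ - 1) * t ^ (γ - 2))

theorem measurable_rieszWeight (γ : ℝ) : Measurable (rieszWeight γ) := by
  unfold rieszWeight; fun_prop

/-- The Beta integral of t^(γ−2)(l − t) over (0, l). Convergence at 0 needs γ > 1, which is why γ =
1 is treated separately. -/
theorem ofReal_rpow_eq_lintegral {γ : ℝ} (hγ : 1 < γ) (l : ℝ) :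
    ENNReal.ofReal ((max l 0) ^ γ) =
      ∫⁻ t in Ioi (0 : ℝ), rieszWeight γ t * ENNReal.ofReal (l - t) := by
  rcases le_or_gt l 0 with hl | hl
  · rw [max_eq_right hl, Real.zero_rpow (by linarith), ENNReal.ofReal_zero, eq_comm]
    refine (setLIntegral_congr_fun measurableSet_Ioi fun t ht => ?_).trans lintegral_zero
    have : l - t ≤ 0 := by linarith [mem_Ioi.1 ht]
    simp [ENNReal.ofReal_of_nonpos this]
  rw [max_eq_left hl.le]
  have hsplit : ∫⁻ t in Ioi (0 : ℝ), rieszWeight γ t * ENNReal.ofReal (l - t) =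
      ∫⁻ t in Ioc (0 : ℝ) l, rieszWeight γ t * ENNReal.ofReal (l - t) := by
    rw [← Ioc_union_Ioi_eq_Ioi hl.le, lintegral_union measurableSet_Ioi
      (Set.disjoint_left.2 fun t h1 h2 => absurd h1.2 (not_le.2 h2))]
    rw [setLIntegral_congr_fun (g := fun _ => 0) measurableSet_Ioi fun t ht => ?_]
    · simp
    · have : l - t ≤ 0 := by linarith [mem_Ioi.1 ht]
      simp [ENNReal.ofReal_of_nonpos this]
  have hi : ∀ r : ℝ, -1 < r → IntervalIntegrable (fun t : ℝ => t ^ r) volume 0 l :=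
    fun r hr => intervalIntegral.intervalIntegrable_rpow' hr
  have hform : ∀ t ∈ Ioc (0 : ℝ) l, γ * (γ - 1) * t ^ (γ - 2) * (l - t) =
      γ * (γ - 1) * (l * t ^ (γ - 2) - t ^ (γ - 1)) := by
    intro t ht
    have : t ^ (γ - 1) = t ^ (γ - 2) * t := by
      rw [← Real.rpow_add_one ht.1.ne']; ring_nf
    rw [this]; ring
  have hint : IntervalIntegrable (fun t : ℝ => γ * (γ - 1) * (l * t ^ (γ - 2) - t ^ (γ - 1)))
      volume 0 l :=
    (((hi _ (by linarith)).const_mul l).sub (hi _ (by linarith))).const_mul _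
  have hval : ∫ t in (0 : ℝ)..l, γ * (γ - 1) * (l * t ^ (γ - 2) - t ^ (γ - 1)) = l ^ γ := by
    rw [intervalIntegral.integral_const_mul, intervalIntegral.integral_sub
      ((hi _ (by linarith)).const_mul l) (hi _ (by linarith)), intervalIntegral.integral_const_mul,
      integral_rpow (Or.inl (by linarith)), integral_rpow (Or.inl (by linarith)),
      show γ - 2 + 1 = γ - 1 by ring, sub_add_cancel, Real.zero_rpow (by linarith),
      Real.zero_rpow (by linarith)]
    have h1 : l ^ γ = l * l ^ (γ - 1) := by
      rw [mul_comm, ← Real.rpow_add_one hl.ne']; ring_nf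
    have h2 : γ - 1 ≠ 0 := by linarith
    have h3 : γ ≠ 0 := by linarith
    rw [h1]
    field_simp
    ring
  rw [hsplit, ← hval, intervalIntegral.integral_of_le hl.le,
    ofReal_integral_eq_lintegral_ofReal]
  · refine setLIntegral_congr_fun measurableSet_Ioc fun t ht => ?_
    rw [← hform t ht, rieszWeight, ← ENNReal.ofReal_mul]
    have := Real.rpow_nonneg ht.1.le (γ - 2)
    have : 0 ≤ γ * (γ - 1) := by nlinarith
    positivity
  · rwa [intervalIntegrable_iff, uIoc_of_le hl.le] at hint
  · filter_upwards [ae_restrict_mem measurableSet_Ioc] with t ht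
    rw [← hform t ht]
    have h1 := Real.rpow_nonneg ht.1.le (γ - 2)
    have h2 : 0 ≤ γ * (γ - 1) := by nlinarith
    have h3 : 0 ≤ l - t := by linarith [ht.2]
    simp only [Pi.zero_apply]
    positivity

theorem continuous_semiclassical {δ : ℝ} (hδ : 0 < δ) (v : ℝ) :
    Continuous fun ξ : ℝ => (max (v - ξ ^ 2) 0) ^ δ :=
  Continuous.rpow_const (by fun_prop) fun _ => Or.inr hδ.le

theorem integrable_semiclassical {δ : ℝ} (hδ : 0 < δ) (v : ℝ) :
    Integrable fun ξ : ℝ => (max (v - ξ ^ 2) 0) ^ δ := by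
  refine (continuous_semiclassical hδ v).integrable_of_hasCompactSupport ?_
  refine HasCompactSupport.intro (K := Icc (-(|v| + 1)) (|v| + 1)) isCompact_Icc fun ξ hξ => ?_
  have : v - ξ ^ 2 ≤ 0 := by
    have h1 : |v| + 1 < |ξ| := by
      by_contra hc
      exact hξ (abs_le.1 (not_lt.1 hc))
    have h2 : ξ ^ 2 = |ξ| ^ 2 := (sq_abs ξ).symm
    nlinarith [le_abs_self v, abs_nonneg v]
  rw [max_eq_right this, Real.zero_rpow hδ.ne']

theorem two_pi_mul_Lcl (δ : ℝ) : 2 * π * Lcl δ = ∫ ξ : ℝ, (max (1 - ξ ^ 2) 0) ^ δ := by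
  unfold Lcl
  field_simp

/-- For v > 0, scaling ξ by √v reduces to the defining integral of `Lcl`. -/
theorem integral_semiclassical {δ : ℝ} (hδ : 0 < δ) (v : ℝ) :
    ∫ ξ : ℝ, (max (v - ξ ^ 2) 0) ^ δ = 2 * π * Lcl δ * (max v 0) ^ (δ + 1 / 2) := by
  rcases le_or_gt v 0 with hv | hv
  · rw [max_eq_right hv, Real.zero_rpow (by linarith), mul_zero]
    refine (integral_congr_ae (.of_forall fun ξ => ?_)).trans (integral_zero ℝ ℝ)
    have : v - ξ ^ 2 ≤ 0 := by nlinarith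
    simp [max_eq_right this, Real.zero_rpow hδ.ne']
  have hs : 0 < √v := Real.sqrt_pos.2 hv
  have hss : √v ^ 2 = v := Real.sq_sqrt hv.le
  have h := Measure.integral_comp_mul_left (fun ξ : ℝ => (max (v - ξ ^ 2) 0) ^ δ) √v
  have hg : ∀ x : ℝ, (max (v - (√v * x) ^ 2) 0) ^ δ = v ^ δ * (max (1 - x ^ 2) 0) ^ δ := by
    intro x
    rw [← Real.mul_rpow hv.le (le_max_right _ _), mul_max_of_nonneg _ _ hv.le, mul_pow, hss]
    ring_nf
  simp only [hg] at h
  rw [integral_const_mul, ← two_pi_mul_Lcl, abs_of_pos (inv_pos.2 hs), smul_eq_mul,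
    inv_mul_eq_div, eq_div_iff hs.ne'] at h
  rw [← h, max_eq_left hv.le, Real.rpow_add hv, ← Real.sqrt_eq_rpow]
  ring

theorem lintegral_semiclassical {δ : ℝ} (hδ : 0 < δ) (v : ℝ) :
    ∫⁻ ξ : ℝ, ENNReal.ofReal ((max (v - ξ ^ 2) 0) ^ δ) =
      ENNReal.ofReal (2 * π * Lcl δ * (max v 0) ^ (δ + 1 / 2)) := by
  rw [← integral_semiclassical hδ, ofReal_integral_eq_lintegral_ofReal
    (integrable_semiclassical hδ v)]
  exact .of_forall fun ξ => Real.rpow_nonneg (le_max_right _ _) _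

theorem Lcl_nonneg (δ : ℝ) : 0 ≤ Lcl δ :=
  mul_nonneg (by positivity) (integral_nonneg fun _ => Real.rpow_nonneg (le_max_right _ _) _)

theorem Lcl_one : Lcl 1 = 2 / (3 * π) := by
  have h : ∫ ξ : ℝ, (max (1 - ξ ^ 2) 0) ^ (1 : ℝ) = 4 / 3 := by
    have h1 : ∫ ξ : ℝ, (max (1 - ξ ^ 2) 0) ^ (1 : ℝ) =
        ∫ ξ in Icc (-1 : ℝ) 1, (max (1 - ξ ^ 2) 0) ^ (1 : ℝ) := by
      refine (setIntegral_eq_integral_of_forall_compl_eq_zero fun ξ hξ => ?_).symm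
      have : 1 - ξ ^ 2 ≤ 0 := by
        have h1 : 1 < |ξ| := by
          by_contra hc
          exact hξ (abs_le.1 (not_lt.1 hc))
        have h2 : ξ ^ 2 = |ξ| ^ 2 := (sq_abs ξ).symm
        nlinarith
      simp [max_eq_right this]
    rw [h1, integral_Icc_eq_integral_Ioc, ← intervalIntegral.integral_of_le (by norm_num)]
    have h2 : ∫ ξ in (-1 : ℝ)..1, (max (1 - ξ ^ 2) 0) ^ (1 : ℝ) =
        ∫ ξ in (-1 : ℝ)..1, (1 - ξ ^ 2) := by
      refine intervalIntegral.integral_congr fun ξ hξ => ?_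
      rw [uIcc_of_le (by norm_num)] at hξ
      have : 0 ≤ 1 - ξ ^ 2 := by nlinarith [hξ.1, hξ.2]
      simp [max_eq_left this]
    rw [h2, intervalIntegral.integral_sub (by simp) (by simp)]
    simp only [intervalIntegral.integral_const, integral_pow]
    norm_num
  rw [Lcl, h]
  field_simp
  norm_num

/-- Aizenman–Lieb: raising the power of `(v - t)₊` costs the ratio of the classical constants. -/
theorem lintegral_rieszWeight {γ : ℝ} (hγ : 1 < γ) (v : ℝ) :
    ∫⁻ t in Ioi (0 : ℝ), rieszWeight γ t * ENNReal.ofReal ((max (v - t) 0) ^ (3 / 2 : ℝ)) =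
      ENNReal.ofReal (Lcl γ / Lcl 1 * (max v 0) ^ (γ + 1 / 2)) := by
  have hpi := Real.pi_pos
  have hL1 : 0 < Lcl 1 := by rw [Lcl_one]; positivity
  have hc : 0 < 2 * π * Lcl 1 := by positivity
  -- The integral of (v − ξ²)₊^γ is computed twice: directly, and by expanding the power in t and
  -- integrating in ξ first, which produces (v − t)₊^{3/2}. Comparison gives the ratio of constants.
  have h1 := lintegral_semiclassical (δ := γ) (by linarith) v
  simp only [ofReal_rpow_eq_lintegral hγ] at h1
  rw [lintegral_lintegral_swap (by
    refine Measurable.aemeasurable ?_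
    have := measurable_rieszWeight γ
    unfold Function.uncurry
    fun_prop)] at h1
  have h2 : ∀ t : ℝ, ∫⁻ ξ : ℝ, rieszWeight γ t * ENNReal.ofReal (v - ξ ^ 2 - t) =
      ENNReal.ofReal (2 * π * Lcl 1) *
        (rieszWeight γ t * ENNReal.ofReal ((max (v - t) 0) ^ (3 / 2 : ℝ))) := by
    intro t
    rw [lintegral_const_mul _ (by fun_prop)]
    have h3 := lintegral_semiclassical one_pos (v - t)
    have h4 : ∀ ξ : ℝ, ENNReal.ofReal ((max (v - t - ξ ^ 2) 0) ^ (1 : ℝ)) =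
        ENNReal.ofReal (v - ξ ^ 2 - t) := by
      intro ξ
      rw [Real.rpow_one, sub_right_comm, ENNReal.ofReal_max]
      simp
    simp only [h4] at h3
    rw [h3, ENNReal.ofReal_mul hc.le]
    norm_num
    ring
  simp only [h2] at h1
  rw [lintegral_const_mul' _ _ ENNReal.ofReal_ne_top] at h1
  have h5 : ENNReal.ofReal (2 * π * Lcl γ * (max v 0) ^ (γ + 1 / 2)) =
      ENNReal.ofReal (2 * π * Lcl 1) *
        ENNReal.ofReal (Lcl γ / Lcl 1 * (max v 0) ^ (γ + 1 / 2)) := by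
    rw [← ENNReal.ofReal_mul hc.le]
    congr 1
    field_simp
  rw [h5] at h1
  exact (ENNReal.mul_right_inj (by simpa using hc) ENNReal.ofReal_ne_top).1 h1

end SemiclassicalConstant

/-! ### Joint measurability of the trace, for Tonelli -/

section Measurability

variable {M : ℕ}

theorem continuous_matrix_cfc {X : Type*} [TopologicalSpace X] {f : ℝ → ℝ} (hf : Continuous f)
    {A : X → Matrix (Fin M) (Fin M) ℂ} (hA : Continuous A) (hs : ∀ x, IsSelfAdjoint (A x)) :
    Continuous fun x => cfc f (A x) := by
  open scoped Matrix.Norms.L2Operator in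
  -- With the L² operator norm the matrices form a C⋆-algebra, where the functional calculus is
  -- continuous in the element.
  let _ : CStarAlgebra (Matrix (Fin M) (Fin M) ℂ) := {}
  exact Continuous.cfc_of_mem_nhdsSet (s := Set.univ) f (by simp) hA hs hf.continuousOn

/-- Moves the shift from the function to the matrix, so that continuity in the matrix alone covers
both variables. -/
theorem cfc_comp_sub {f : ℝ → ℝ} (hf : Continuous f) {W : Matrix (Fin M) (Fin M) ℂ}
    (hW : W.IsHermitian) (t : ℝ) :
    cfc (fun s => f (s - t)) W = cfc f (W - algebraMap ℝ (Matrix (Fin M) (Fin M) ℂ) t) := by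
  have hW' : IsSelfAdjoint W := hW
  have h1 : cfc (fun s : ℝ => s - t) W = W - algebraMap ℝ (Matrix (Fin M) (Fin M) ℂ) t := by
    rw [cfc_sub (fun s : ℝ => s) (fun _ => t) W, cfc_id' ℝ W, cfc_const t W]
  rw [← h1, ← cfc_comp' f (fun s : ℝ => s - t) W hf.continuousOn]

theorem measurable_trace_cfc {f : ℝ → ℝ} (hf : Continuous f) {W : ℝ → Matrix (Fin M) (Fin M) ℂ}
    (hW : ∀ x, (W x).IsHermitian) (hm : ∀ i j, Measurable fun x => W x i j) :
    Measurable fun p : ℝ × ℝ => (Matrix.trace (cfc (fun s => f (s - p.1)) (W p.2))).re := by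
  -- Symmetrising gives a continuous map on all matrices with self-adjoint values; it leaves
  -- Hermitian matrices unchanged up to the shift.
  let herm : ℝ × (Fin M → Fin M → ℂ) → Matrix (Fin M) (Fin M) ℂ := fun p =>
    (1 / 2 : ℝ) • (Matrix.of p.2 + (Matrix.of p.2).conjTranspose) -
      algebraMap ℝ (Matrix (Fin M) (Fin M) ℂ) p.1
  have hcont : Continuous herm := by
    have h1 : Continuous fun p : ℝ × (Fin M → Fin M → ℂ) => Matrix.of p.2 := continuous_snd
    have h2 : Continuous fun p : ℝ × (Fin M → Fin M → ℂ) =>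
        algebraMap ℝ (Matrix (Fin M) (Fin M) ℂ) p.1 := by
      simp only [Algebra.algebraMap_eq_smul_one]
      fun_prop
    exact ((h1.add h1.matrix_conjTranspose).const_smul (1 / 2 : ℝ)).sub h2
  have hsa : ∀ p, IsSelfAdjoint (herm p) := by
    intro p
    refine IsSelfAdjoint.sub (IsSelfAdjoint.smul (IsSelfAdjoint.all _) ?_)
      (IsSelfAdjoint.algebraMap _ (IsSelfAdjoint.all _))
    exact IsSelfAdjoint.add_star_self (Matrix.of p.2)
  have hΦ : Continuous fun p => (Matrix.trace (cfc f (herm p))).re :=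
    Complex.continuous_re.comp (continuous_matrix_cfc hf hcont hsa).matrix_trace
  have hmeas : Measurable fun p : ℝ × ℝ => (p.1, fun i j => W p.2 i j) :=
    measurable_fst.prodMk (measurable_pi_lambda _ fun i => measurable_pi_lambda _ fun j =>
      (hm i j).comp measurable_snd)
  convert hΦ.measurable.comp hmeas using 1
  funext p
  simp only [Function.comp_apply]
  rw [cfc_comp_sub hf (hW p.2)]
  congr 3
  simp only [herm]
  have : (Matrix.of fun i j => W p.2 i j) = W p.2 := rfl
  rw [this, (hW p.2).eq, ← two_smul ℝ, smul_smul]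
  norm_num

theorem exists_measurable_hermitian {V : ℝ → Matrix (Fin M) (Fin M) ℂ} {μ : Measure ℝ}
    (hm : ∀ i j, AEMeasurable (fun x => V x i j) μ) (hV : ∀ᵐ x ∂μ, (V x).IsHermitian) :
    ∃ W : ℝ → Matrix (Fin M) (Fin M) ℂ, (∀ i j, Measurable fun x => W x i j) ∧
      (∀ x, (W x).IsHermitian) ∧ ∀ᵐ x ∂μ, V x = W x := by
  refine ⟨fun x => Matrix.of fun i j =>
    (1 / 2 : ℂ) * ((hm i j).mk _ x + starRingEnd ℂ ((hm j i).mk _ x)), fun i j => ?_,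
    fun x => ?_, ?_⟩
  · have h1 := (hm i j).measurable_mk
    have h2 := (hm j i).measurable_mk
    have h3 : Measurable fun x => starRingEnd ℂ ((hm j i).mk _ x) :=
      Complex.continuous_conj.measurable.comp h2
    exact (h1.add h3).const_mul _
  · ext i j
    simp [Matrix.conjTranspose_apply, add_comm]
  · have h1 : ∀ᵐ x ∂μ, ∀ i j, V x i j = (hm i j).mk _ x :=
      ae_all_iff.2 fun i => ae_all_iff.2 fun j => (hm i j).ae_eq_mk
    filter_upwards [h1, hV] with x h1 h2
    ext i j
    rw [Matrix.of_apply, ← h1, ← h1]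
    have := h2.apply i j
    rw [starRingEnd_apply, this]
    ring

end Measurability

/-! ### From finite orthonormal families to the Riesz mean -/

section Counting

variable {M : ℕ} {a : ℝ → ℝ} {V : ℝ → Matrix (Fin M) (Fin M) ℂ}

/-- Both eigenfunctions lie in the form domain, so each may test the other's equation; the form is
Hermitian and the eigenvalues are real. -/
theorem inner_eq_zero_of_mem_eigenspace (hV : ∀ᵐ x ∂circleMeasure, (V x).IsHermitian) {E E' : ℝ}
    (hE : E ≠ E') {u v : L2 M} (hu : u ∈ eigenspace a V E) (hv : v ∈ eigenspace a V E') :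
    inner ℂ v u = 0 := by
  obtain ⟨g, hg, H⟩ := hu
  obtain ⟨k, hk, H'⟩ := hv
  have h1 := (H v k hk).2
  have h2 := congrArg (starRingEnd ℂ) (H' u g hg).2
  simp only [LinearMap.prod_apply, Function.prod_apply, LinearMap.id_apply,
    LinearMap.smul_apply, inner_smul_right] at h1 h2
  rw [map_sub, map_mul, inner_conj_symm, inner_conj_symm, ← integral_conj, Complex.conj_ofReal] at h2
  have h3 : ∫ x, starRingEnd ℂ (potentialDensity V u v x) ∂circleMeasure =
      ∫ x, potentialDensity V v u x ∂circleMeasure := by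
    refine integral_congr_ae ?_
    filter_upwards [hV] with x hx
    have hs := Matrix.isSymmetric_toEuclideanLin_iff.2 hx
    simp only [potentialDensity, inner_conj_symm]
    exact hs _ _
  rw [h3, h1] at h2
  have h4 : ((E : ℂ) - E') * inner ℂ v u = 0 := by rw [sub_mul, h2, sub_self]
  exact (mul_eq_zero.1 h4).resolve_left (sub_ne_zero.2 (by exact_mod_cast hE))

/-- An inequality in place of equality also covers infinite multiplicity, not yet excluded. -/
theorem exists_orthonormal_of_le_multiplicity {E : ℝ} {n : ℕ}
    (hn : (n : ℕ∞) ≤ multiplicity a V E) :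
    ∃ v : Fin n → L2 M, Orthonormal ℂ v ∧ ∀ i, v i ∈ eigenspace a V E := by
  rw [multiplicity, Cardinal.natCast_le_toENat, le_rank_iff_exists_linearIndependent_finset] at hn
  obtain ⟨s, hs, hli⟩ := hn
  have e : Fin n ≃ s := (Fintype.equivFinOfCardEq (by simpa using hs)).symm
  have hli' : LinearIndependent ℂ fun i : Fin n => ((e i : s) : eigenspace a V E) :=
    hli.comp e e.injective
  have ho := InnerProductSpace.gramSchmidtNormed_orthonormal hli'
  refine ⟨fun i => (InnerProductSpace.gramSchmidtNormed ℂ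
    (fun i : Fin n => ((e i : s) : eigenspace a V E)) i : eigenspace a V E), ?_, fun i => ?_⟩
  · exact ho.comp_linearIsometry (eigenspace a V E).subtypeₗᵢ
  · exact Submodule.coe_mem _

theorem sum_mul_le_of_le_multiplicity (hV : ∀ᵐ x ∂circleMeasure, (V x).IsHermitian) {γ : ℝ}
    {B : ℝ≥0∞}
    (h : ∀ (ι : Type) [Fintype ι] (u : ι → L2 M) (l : ι → ℝ), Orthonormal ℂ u → (∀ i, 0 < l i) →
      (∀ i, u i ∈ eigenspace a V (-l i)) → ∑ i, ENNReal.ofReal (l i ^ γ) ≤ B)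
    (S : Finset (Iio (0 : ℝ))) (n : Iio (0 : ℝ) → ℕ)
    (hn : ∀ E ∈ S, (n E : ℕ∞) ≤ multiplicity a V E) :
    ∑ E ∈ S, ENNReal.ofReal ((-(E : ℝ)) ^ γ) * (n E : ℝ≥0∞) ≤ B := by
  have hex : ∀ E : S, ∃ v : Fin (n E) → L2 M, Orthonormal ℂ v ∧
      ∀ i, v i ∈ eigenspace a V (E : Iio (0 : ℝ)) :=
    fun E => exists_orthonormal_of_le_multiplicity (hn E E.2)
  choose v hv hvE using hex
  have := h (Σ E : S, Fin (n E)) (fun p => v p.1 p.2) (fun p => -((p.1 : Iio (0 : ℝ)) : ℝ)) ?_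
    (fun p => neg_pos.2 (p.1 : Iio (0 : ℝ)).2) (fun p => by rw [neg_neg]; exact hvE _ _)
  · rw [Fintype.sum_sigma] at this
    simp only [Finset.sum_const, Finset.card_univ, Fintype.card_fin, nsmul_eq_mul] at this
    rw [← Finset.sum_coe_sort]
    simpa only [mul_comm] using this
  · refine ⟨fun p => (hv p.1).1 p.2, ?_⟩
    rintro ⟨E, i⟩ ⟨E', j⟩ hne
    by_cases hE : E = E'
    · subst hE
      exact (hv E).2 fun hij => hne (congrArg (Sigma.mk E) (show i = j from hij))
    · exact inner_eq_zero_of_mem_eigenspace hV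
        (fun he => hE (Subtype.ext (Subtype.ext he.symm))) (hvE E' j) (hvE E i)

/-- The bound on finite families itself rules out infinite multiplicity: enough orthonormal
eigenfunctions for one eigenvalue would exceed `B`. The sum is then a supremum over finite sets of
eigenvalues. -/
theorem rieszMean_le (hV : ∀ᵐ x ∂circleMeasure, (V x).IsHermitian) {γ : ℝ}
    {B : ℝ≥0∞} (hB : B ≠ ⊤)
    (h : ∀ (ι : Type) [Fintype ι] (u : ι → L2 M) (l : ι → ℝ), Orthonormal ℂ u → (∀ i, 0 < l i) →
      (∀ i, u i ∈ eigenspace a V (-l i)) → ∑ i, ENNReal.ofReal (l i ^ γ) ≤ B) :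
    rieszMean a V γ ≤ B := by
  have key := sum_mul_le_of_le_multiplicity hV h
  have hfin : ∀ E : Iio (0 : ℝ), multiplicity a V E ≠ ⊤ := by
    intro E hE
    have hpos : ENNReal.ofReal ((-(E : ℝ)) ^ γ) ≠ 0 := by
      simpa using Real.rpow_pos_of_pos (neg_pos.2 E.2) γ
    obtain ⟨n, hn⟩ := ENNReal.exists_nat_mul_gt hpos hB
    have := key {E} (fun _ => n) (by simp [hE])
    rw [Finset.sum_singleton, mul_comm] at this
    exact absurd this (not_le.2 hn)
  rw [rieszMean, ENNReal.tsum_eq_iSup_sum]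
  refine iSup_le fun S => ?_
  refine le_trans (le_of_eq ?_) (key S (fun E => (multiplicity a V E).toNat)
    fun E _ => (ENat.natCast_toNat (hfin E)).le)
  refine Finset.sum_congr rfl fun E _ => ?_
  congr 1
  conv_lhs => rw [← ENat.natCast_toNat (hfin E)]
  simp

end Counting

/-! ### The Lieb–Thirring inequality -/

theorem tracePow_eq_sum {M : ℕ} {W : Matrix (Fin M) (Fin M) ℂ} (hW : W.IsHermitian) (s : ℝ) :
    tracePow W s = ∑ k, hW.eigenvalues k ^ s := trace_cfc_re hW _

theorem tracePow_nonneg {M : ℕ} {W : Matrix (Fin M) (Fin M) ℂ} (hW : W.PosSemidef) (s : ℝ) :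
    0 ≤ tracePow W s := by
  rw [tracePow_eq_sum hW.isHermitian]
  exact Finset.sum_nonneg fun k _ => Real.rpow_nonneg (hW.eigenvalues_nonneg k) _

theorem lintegral_rieszWeight_trace {M : ℕ} {γ c : ℝ} (hγ : 1 < γ) (hc : 0 ≤ c)
    {W : Matrix (Fin M) (Fin M) ℂ} (hW : W.PosSemidef) :
    ∫⁻ t in Ioi (0 : ℝ), rieszWeight γ t * ENNReal.ofReal (c *
      (Matrix.trace (cfc (fun s : ℝ => (max (s - t) 0) ^ (3 / 2 : ℝ)) W)).re) =
    ENNReal.ofReal (c * (Lcl γ / Lcl 1) * tracePow W (γ + 1 / 2)) := by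
  have h1 : ∀ t : ℝ, rieszWeight γ t * ENNReal.ofReal (c *
      (Matrix.trace (cfc (fun s : ℝ => (max (s - t) 0) ^ (3 / 2 : ℝ)) W)).re) =
      ENNReal.ofReal c * ∑ k, rieszWeight γ t *
        ENNReal.ofReal ((max (hW.isHermitian.eigenvalues k - t) 0) ^ (3 / 2 : ℝ)) := by
    intro t
    rw [trace_cfc_re hW.isHermitian, ENNReal.ofReal_mul hc, ENNReal.ofReal_sum_of_nonneg
      fun k _ => Real.rpow_nonneg (le_max_right _ _) _, ← Finset.mul_sum]
    ring
  have hL : 0 ≤ Lcl γ / Lcl 1 := div_nonneg (Lcl_nonneg _) (Lcl_nonneg _)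
  simp only [h1]
  rw [lintegral_const_mul' _ _ ENNReal.ofReal_ne_top, lintegral_finsetSum _ fun k _ =>
    show Measurable fun t : ℝ => rieszWeight γ t *
      ENNReal.ofReal ((max (hW.isHermitian.eigenvalues k - t) 0) ^ (3 / 2 : ℝ)) from
    (measurable_rieszWeight γ).mul (by fun_prop)]
  simp only [lintegral_rieszWeight hγ]
  rw [← ENNReal.ofReal_sum_of_nonneg fun k _ => mul_nonneg hL (Real.rpow_nonneg (le_max_right _ _) _),
    ← ENNReal.ofReal_mul hc, ← Finset.mul_sum, ← mul_assoc, tracePow_eq_sum hW.isHermitian]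
  simp only [max_eq_left (hW.eigenvalues_nonneg _)]

/-- The Lieb–Thirring bound for a finite orthonormal family of eigenfunctions. -/
theorem sum_rpow_le {M : ℕ} {ι : Type*} [Fintype ι] {a : ℝ → ℝ} {α γ : ℝ} (hγ : 1 ≤ γ)
    (hα : ∀ n : ℤ, α ≠ n) (ha : IntervalIntegrable a volume 0 (2 * π)) (hflux : flux a = α)
    {V : ℝ → Matrix (Fin M) (Fin M) ℂ} (hm : ∀ i j, AEMeasurable (fun x => V x i j) circleMeasure)
    (hV : ∀ᵐ x ∂circleMeasure, (V x).PosSemidef)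
    (hint : Integrable (fun x => tracePow (V x) (γ + 1 / 2)) circleMeasure)
    {u : ι → L2 M} (hu : Orthonormal ℂ u) {l : ι → ℝ} (hl0 : ∀ i, 0 < l i)
    (hl : ∀ i, u i ∈ eigenspace a V (-l i)) :
    ∑ i, ENNReal.ofReal (l i ^ γ) ≤ ENNReal.ofReal (2 / (3 * √3) * K α * (Lcl γ / Lcl 1) *
      ∫ x in (0 : ℝ)..(2 * π), tracePow (V x) (γ + 1 / 2)) := by
  have hVh : ∀ᵐ x ∂circleMeasure, (V x).IsHermitian := hV.mono fun x hx => hx.isHermitian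
  have hc : 0 ≤ 2 / (3 * √3) * K α := mul_nonneg (by positivity) (K_nonneg α)
  have hL : 0 ≤ Lcl γ / Lcl 1 := div_nonneg (Lcl_nonneg _) (Lcl_nonneg _)
  have hR : ENNReal.ofReal (2 / (3 * √3) * K α * (Lcl γ / Lcl 1) *
      ∫ x in (0 : ℝ)..(2 * π), tracePow (V x) (γ + 1 / 2)) =
      ∫⁻ x, ENNReal.ofReal (2 / (3 * √3) * K α * (Lcl γ / Lcl 1) * tracePow (V x) (γ + 1 / 2))
        ∂circleMeasure := by
    rw [intervalIntegral.integral_of_le (by positivity), ← integral_const_mul,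
      ofReal_integral_eq_lintegral_ofReal (hint.const_mul _)]
    filter_upwards [hV] with x hx
    exact mul_nonneg (mul_nonneg hc hL) (tracePow_nonneg hx _)
  rw [hR]
  set T : ℝ → Matrix (Fin M) (Fin M) ℂ → ℝ := fun t W =>
    (Matrix.trace (cfc (fun s : ℝ => (max (s - t) 0) ^ (3 / 2 : ℝ)) W)).re with hT
  rcases hγ.eq_or_lt with rfl | hγ1
  · have h1 := ofReal_sum_sub_le hα ha hflux hVh hu hl 0
    have hL1 : Lcl 1 ≠ 0 := by rw [Lcl_one]; positivity
    simp only [sub_zero] at h1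
    rw [ENNReal.ofReal_sum_of_nonneg fun i _ => (hl0 i).le] at h1
    simp only [Real.rpow_one]
    refine h1.trans_eq (lintegral_congr_ae ?_)
    filter_upwards [hV] with x hx
    rw [div_self hL1, mul_one, trace_cfc_re hx.isHermitian, tracePow_eq_sum hx.isHermitian]
    simp only [max_eq_left (hx.eigenvalues_nonneg _)]
    norm_num
  -- A version of V that is measurable and Hermitian everywhere, as the interchange of the t and x
  -- integrals requires.
  · obtain ⟨W, hWm, hWh, hWV⟩ := exists_measurable_hermitian hm hVh
    have hmeasT : Measurable fun p : ℝ × ℝ => T p.1 (W p.2) :=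
      measurable_trace_cfc (f := fun s : ℝ => (max s 0) ^ (3 / 2 : ℝ))
        (Continuous.rpow_const (by fun_prop) fun _ => Or.inr (by norm_num)) hWh hWm
    have hshift : ∀ t : ℝ, ∑ i, ENNReal.ofReal (l i - t) ≤
        ∫⁻ x, ENNReal.ofReal (2 / (3 * √3) * K α * T t (W x)) ∂circleMeasure := by
      intro t
      classical
      -- Keeping only the eigenfunctions with l_i > t turns the sum of l_i − t into the sum of
      -- positive parts.
      have h1 := ofReal_sum_sub_le hα ha hflux hVh (u := fun i : {i // t < l i} => u i)
        (hu.comp _ Subtype.val_injective) (l := fun i => l i) (fun i => hl i) t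
      rw [ENNReal.ofReal_sum_of_nonneg fun i _ => sub_nonneg.2 i.2.le] at h1
      have h2 : ∑ i, ENNReal.ofReal (l i - t) = ∑ i : {i // t < l i}, ENNReal.ofReal (l i - t) := by
        rw [← Finset.sum_subtype (Finset.univ.filter fun i => t < l i) (by simp)
          fun i => ENNReal.ofReal (l i - t), Finset.sum_filter_of_ne]
        intro i _ hi
        by_contra hc
        exact hi (ENNReal.ofReal_of_nonpos (by linarith))
      rw [h2]
      refine h1.trans_eq (lintegral_congr_ae ?_)
      filter_upwards [hWV] with x hx
      rw [hx]
    calc ∑ i, ENNReal.ofReal (l i ^ γ)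
        = ∑ i, ∫⁻ t in Ioi (0 : ℝ), rieszWeight γ t * ENNReal.ofReal (l i - t) :=
          Finset.sum_congr rfl fun i _ => by
            rw [← ofReal_rpow_eq_lintegral hγ1, max_eq_left (hl0 i).le]
      _ = ∫⁻ t in Ioi (0 : ℝ), rieszWeight γ t * ∑ i, ENNReal.ofReal (l i - t) := by
          simp only [Finset.mul_sum]
          exact (lintegral_finsetSum _ fun i _ =>
            (measurable_rieszWeight γ).mul (by fun_prop)).symm
      _ ≤ ∫⁻ t in Ioi (0 : ℝ), rieszWeight γ t *
            ∫⁻ x, ENNReal.ofReal (2 / (3 * √3) * K α * T t (W x)) ∂circleMeasure := by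
          gcongr with t
          exact hshift t
      _ = ∫⁻ t in Ioi (0 : ℝ), ∫⁻ x, rieszWeight γ t *
            ENNReal.ofReal (2 / (3 * √3) * K α * T t (W x)) ∂circleMeasure := by
          refine lintegral_congr fun t => (lintegral_const_mul _ ?_).symm
          exact ((hmeasT.comp (measurable_const.prodMk measurable_id)).const_mul _).ennreal_ofReal
      _ = ∫⁻ x, (∫⁻ t in Ioi (0 : ℝ), rieszWeight γ t *
            ENNReal.ofReal (2 / (3 * √3) * K α * T t (W x))) ∂circleMeasure := by
          refine lintegral_lintegral_swap (Measurable.aemeasurable ?_)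
          exact ((measurable_rieszWeight γ).comp measurable_fst).mul
            (hmeasT.const_mul _).ennreal_ofReal
      _ = _ := by
          refine lintegral_congr_ae ?_
          filter_upwards [hWV, hV] with x hx hVx
          rw [← hx]
          exact lintegral_rieszWeight_trace hγ1 hc hVx

end MagneticLT

theorem corollary1 (γ : ℝ) (hγ : 1 ≤ γ) (α : ℝ) (hα : ∀ n : ℤ, α ≠ n) :
    ∃ L : ℝ, 0 ≤ L ∧
      L ≤ 2 / (3 * √3) * MagneticLT.K α * (MagneticLT.Lcl γ / MagneticLT.Lcl 1) ∧
      2 / (3 * √3) * MagneticLT.K α * (MagneticLT.Lcl γ / MagneticLT.Lcl 1) =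
        π / √3 * MagneticLT.K α * MagneticLT.Lcl γ ∧
      ∀ (M : ℕ) (a : ℝ → ℝ) (V : ℝ → Matrix (Fin M) (Fin M) ℂ),
        IntervalIntegrable a volume 0 (2 * π) →
        MagneticLT.flux a = α →
        (∀ i j, AEMeasurable (fun x => V x i j) MagneticLT.circleMeasure) →
        (∀ᵐ x ∂MagneticLT.circleMeasure, (V x).PosSemidef) →
        Integrable (fun x => MagneticLT.tracePow (V x) (γ + 1 / 2)) MagneticLT.circleMeasure →
        MagneticLT.rieszMean a V γ ≤
          ENNReal.ofReal
            (L * ∫ x in (0 : ℝ)..(2 * π), MagneticLT.tracePow (V x) (γ + 1 / 2)) := by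
  refine ⟨2 / (3 * √3) * MagneticLT.K α * (MagneticLT.Lcl γ / MagneticLT.Lcl 1), ?_, le_rfl, ?_,
    fun M a V ha hflux hm hV hint => ?_⟩
  · have := MagneticLT.K_nonneg α
    have := MagneticLT.Lcl_nonneg γ
    have := MagneticLT.Lcl_nonneg 1
    positivity
  -- L^cl_1 = 2/(3π), hence the factor π/√3.
  · rw [MagneticLT.Lcl_one]
    field_simp
  · exact MagneticLT.rieszMean_le (hV.mono fun x hx => hx.isHermitian) ENNReal.ofReal_ne_top
      fun ι _ u l hu hl0 hl => MagneticLT.sum_rpow_le hγ hα ha hflux hm hV hint hu hl0 hl
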